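/- **Setting.** A stream is a sequence $\sigma=((x_1,y_1),\dots,(x_m,y_m))$, $m\ge 1$, with $x_i\in\{1,\dots,N\}$ and $y_i\in\{-1,+1\}$. The Gini impurity of a nonempty finite multiset $S$ of labels is $\mathrm{Gini}(S)=1-\sum_{y}(|S_y|/|S|)^2$, where $S_y$ is the multiset of elements of $S$ equal to $y$, and $\mathrm{Gini}(\emptyset)=0$. For a split $j\in\{0,\dots,N\}$ let $A_j=\{\!\{y_i : x_i\le j\}\!\}$, $B_j=\{\!\{y_i : x_i\ge j+1\}\!\}$ and $$L_{\mathrm{Gini}}(j)=\frac{|A_j|}{m}\,\mathrm{Gini}(A_j)+\frac{|B_j|}{m}\,\mathrm{Gini}(B_j),\qquad \mathrm{OPT}_{\mathrm{Gini}}=\min_{0\le j\le N}L_{\mathrm{Gini}}(j).$$ A randomized one-pass streaming algorithm is a triple of fixed word-RAM programs: one run before the stream, one run on each arriving item, one run after the stream. It is given $N$ and $\lceil 1/\varepsilon\rceil$, but not the stream length $m$. Memory cells hold natural numbers. In unit time a program can write a constant, add, subtract (truncated at $0$), multiply, divide with remainder, compare, load or store through an address held in a cell, draw a uniformly random integer from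 $\{0,\dots,n-1\}$ for an $n$ held in a cell, branch, or start or perform an iteration of a counted loop. The word length is the number of bits of the largest value ever held in a cell. The space is the number of memory cells (up to the largest address used) plus the maximal number of simultaneously active loop counters, times the word length, in bits. The update time is the number of steps spent on an arriving item. **Theorem.** For every $c\in\mathbb N$ there are a randomized one-pass streaming algorithm, a real constant $C$ and $d\in\mathbb N$ such that for every $\varepsilon\in(0,1)$, every $N$ and every stream $\sigma$ as above, with $\Lambda=\log(2Nm/\varepsilon)$: 1. in every execution, the word length is at most $C\Lambda$ and the space is at most $\frac{C}{\varepsilon}\Lambda^{d}$ bits, i.e. $\widetilde O(1/\varepsilon)$; 2. in every execution, the update time is at most $C\Lambda^{d}$, i.e. $\widetilde O(1)$; 3. with probability at least $1-(N+1)^{-c}$ the output $\hat\jmath$ satisfies $\hat\jmath\in\{0,\dots,N\}$ and $L_{\mathrm{Gini}}(\hat\jmath)\le \mathrm{OPT}_{\mathrm{Gini}}+\varepsilon$. -/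

import Mathlib

open scoped ENNReal

noncomputable section

namespace GiniStream

/-! The machine: a randomized word RAM, programmed in a small structured language. -/

/-- The binary operations of the machine, on natural-number words
(`sub` is truncated, `div` and `mod` are integer division, `lt` and `eq` return `0` or `1`). -/
inductive Op
  | add | sub | mul | div | mod | lt | eq

def Op.eval : Op → ℕ → ℕ → ℕ
  | .add, u, v => u + v
  | .sub, u, v => u - v
  | .mul, u, v => u * v
  | .div, u, v => u / v
  | .mod, u, v => u % v
  | .lt, u, v => if u < v then 1 else 0
  | .eq, u, v => if u = v then 1 else 0

/-- Programs. All arguments except the literal `k` are addresses of memory cells; `mem[a]` is the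
content of cell `a`.
* `skip` does nothing;
* `const d k` is `mem[d] := k`;
* `op o d a b` is `mem[d] := mem[a] o mem[b]`;
* `load d a` is `mem[d] := mem[mem[a]]`;
* `store a b` is `mem[mem[a]] := mem[b]`;
* `rand d a` puts into cell `d` a fresh uniformly random element of `{0, …, mem[a] - 1}`;
* `seq p q` runs `p`, then `q`;
* `ite a p q` runs `p` if `mem[a] ≠ 0` and `q` otherwise;
* `loop a p` runs `p` as many times as the value that `mem[a]` has on entry. -/
inductive Cmd
  | skip
  | const (d k : ℕ)
  | op (o : Op) (d a b : ℕ)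
  | load (d a : ℕ)
  | store (a b : ℕ)
  | rand (d a : ℕ)
  | seq (p q : Cmd)
  | ite (a : ℕ) (p q : Cmd)
  | loop (a : ℕ) (p : Cmd)

/-- The nesting depth of the loops of a program: the number of loop counters that are live at the
same time. -/
def Cmd.loopDepth : Cmd → ℕ
  | .seq p q => max p.loopDepth q.loopDepth
  | .ite _ p q => max p.loopDepth q.loopDepth
  | .loop _ p => p.loopDepth + 1
  | _ => 0

/-- A memory together with the resources used so far. -/
structure Config where
  /-- the contents of the memory cells -/
  mem : ℕ → ℕ
  /-- the number of elementary steps executed since the clock was last reset -/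
  time : ℕ
  /-- all cells that were ever read or written have an address below `cells` -/
  cells : ℕ
  /-- the largest value that any cell ever held -/
  top : ℕ

namespace Config

/-- Spend one elementary step. -/
def tick (s : Config) : Config := { s with time := s.time + 1 }

/-- Record an access to cell `a`. -/
def touch (s : Config) (a : ℕ) : Config := { s with cells := max s.cells (a + 1) }

/-- Write `v` into cell `a`. -/
def put (s : Config) (a v : ℕ) : Config :=
  { mem := Function.update s.mem a v
    time := s.time
    cells := max s.cells (a + 1)
    top := max s.top v }

/-- The word length, in bits, that suffices for every value held so far. -/
def wordLength (s : Config) : ℕ := s.top.size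

end Config

/-- The uniform distribution on `{0, …, n - 1}` (and the point mass at `0` if `n = 0`). -/
def randBelow (n : ℕ) : PMF ℕ :=
  if h : (Finset.range n).Nonempty then PMF.uniformOfFinset (Finset.range n) h else PMF.pure 0

/-- The distribution of the configuration after running a program. Every instruction, every test
of a conditional, every entry of a loop and every iteration of a loop costs one step. -/
def Cmd.exec : Cmd → Config → PMF Config
  | .skip, s => PMF.pure s
  | .const d k, s => PMF.pure (s.tick.put d k)
  | .op o d a b, s =>
      PMF.pure (((s.tick.touch a).touch b).put d (o.eval (s.mem a) (s.mem b)))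
  | .load d a, s => PMF.pure (((s.tick.touch a).touch (s.mem a)).put d (s.mem (s.mem a)))
  | .store a b, s => PMF.pure (((s.tick.touch a).touch b).put (s.mem a) (s.mem b))
  | .rand d a, s => (randBelow (s.mem a)).map fun v => (s.tick.touch a).put d v
  | .seq p q, s => (p.exec s).bind fun t => q.exec t
  | .ite a p q, s =>
      if s.mem a ≠ 0 then p.exec (s.tick.touch a) else q.exec (s.tick.touch a)
  | .loop a p, s =>
      (fun P : PMF Config => P.bind fun t => p.exec t.tick)^[s.mem a] (PMF.pure (s.tick.touch a))

/-! One-pass streaming algorithms. -/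

/-- A one-pass streaming algorithm: a program that is run before the stream, one that is run on
every arriving item, and one that is run after the stream. -/
structure StreamAlg where
  setup : Cmd
  update : Cmd
  finish : Cmd

namespace StreamAlg

/-- The memory on start: `N` in cell `0`, `E` in cell `1`, and `0` elsewhere. -/
def start (N E : ℕ) : Config where
  mem := fun a => if a = 0 then N else if a = 1 then E else 0
  time := 0
  cells := 2
  top := max N E

/-- A label as a machine word: `+1` is presented as `1` and `-1` as `0`. -/
def encode (y : ℤˣ) : ℕ := if y = 1 then 1 else 0

/-- Process one item `(x, y)`: it is placed in cells `2` and `3`, the clock is reset, and the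
update program is run. -/
def feed (A : StreamAlg) (s : Config) (p : ℕ × ℤˣ) : PMF Config :=
  A.update.exec { (s.put 2 p.1).put 3 (encode p.2) with time := 0 }

/-- The distribution of the configuration after one pass over a stream; its `time` is the time
spent on the last item of the stream. -/
def after (A : StreamAlg) (N E : ℕ) (σ : List (ℕ × ℤˣ)) : PMF Config :=
  σ.foldl (fun P p => P.bind fun s => A.feed s p) (A.setup.exec (start N E))

/-- The distribution of the final configuration; the output is in cell `0`. -/
def run (A : StreamAlg) (N E : ℕ) (σ : List (ℕ × ℤˣ)) : PMF Config :=
  (A.after N E σ).bind fun s => A.finish.exec s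

/-- The largest number of loop counters that the algorithm ever has to keep simultaneously. -/
def loopDepth (A : StreamAlg) : ℕ :=
  max A.setup.loopDepth (max A.update.loopDepth A.finish.loopDepth)

/-- The space in bits of an execution that ends in `s`: (memory cells plus loop counters) times
the word length. Both `cells` and `top` are running maxima, so this is the peak space. -/
def spaceBits (A : StreamAlg) (s : Config) : ℕ := (s.cells + A.loopDepth) * s.wordLength

end StreamAlg

/-! The Gini split problem. Labels in `{-1, +1}` are the units of `ℤ`. -/

/-- The Gini impurity of a multiset of labels, `0` for the empty multiset. -/
def gini (S : Multiset ℤˣ) : ℝ :=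
  if S = 0 then 0
  else 1 - ∑ y ∈ S.toFinset, ((S.count y : ℝ) / (Multiset.card S : ℝ)) ^ 2

/-- The labels of the items with `x ≤ j`. -/
def leftLabels (σ : List (ℕ × ℤˣ)) (j : ℕ) : Multiset ℤˣ :=
  ((σ.filter fun p => p.1 ≤ j).map Prod.snd : List ℤˣ)

/-- The labels of the items with `x ≥ j + 1`. -/
def rightLabels (σ : List (ℕ × ℤˣ)) (j : ℕ) : Multiset ℤˣ :=
  ((σ.filter fun p => j + 1 ≤ p.1).map Prod.snd : List ℤˣ)

/-- The Gini loss of the split `j`. -/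
def giniLoss (σ : List (ℕ × ℤˣ)) (j : ℕ) : ℝ :=
  (Multiset.card (leftLabels σ j) : ℝ) / (σ.length : ℝ) * gini (leftLabels σ j) +
    (Multiset.card (rightLabels σ j) : ℝ) / (σ.length : ℝ) * gini (rightLabels σ j)

/-- The optimal Gini loss over the splits `0, …, N`. -/
def optGini (N : ℕ) (σ : List (ℕ × ℤˣ)) : ℝ :=
  (Finset.range (N + 1)).inf' Finset.nonempty_range_add_one (giniLoss σ)

end GiniStream

end

open scoped ENNReal

noncomputable section

namespace GiniStream

/-! The algorithm is deterministic, so the probability bound holds with probability one. It keeps a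
binary trie over `[0, 2 ^ L)`, where `N < 2 ^ L ≤ 2 * N`. Put `E = ⌈1/ε⌉` and `K = 16 * L * E`. The
item arriving at time `t` walks down its binary path from the root and stays at the first node that
is a leaf or satisfies `(tot + 1) * K ≤ t`; missing nodes on the way are created. Nodes are never
merged or removed.

Accuracy. A node above the leaves holds at most `t / K` items. For a split `j`, the side of an item
is unknown only if its node's interval contains both `j` and `j + 1`. There is at most one such node
on each of the levels `1, …, L`, so at most `L * t / K = t / (16 * E)` items are in doubt
(`Trie.across_le`, `Trie.Counts`). The loss is `2 / t` times the sum of `p * q / (p + q)` over the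
two sides. This function is monotone and 1-Lipschitz in each argument (`impurity_add`), so misplaced
items change the sum by at most their number, and a minimizer of the rounded estimate is within `ε`
of the optimum (`giniLoss_le_of_score`).

Space. Every item insertion and every node creation at time `t` deposits a credit `1 / t` at the
node receiving the item or the child. Then a node with `tot` items always has credit at least `tot /
t`. When it gets a child, `(tot + 1) * K > t`, so with the new deposit its credit exceeds `1 / K`,
enough to charge both possible children at rate `2 * K` (`Trie.Credit.alloc`). An item causes at
most `L + 1` deposits, so after `n` items the total credit is at most `(L + 1)` times the harmonic
number of `n`, and the trie has at most `1 + 2 * K * (L + 1) * (1 + log n)` nodes.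

Machine. A weakest-precondition calculus with built-in bounds on addresses and values
(`Cmd.wp_sound`) shows that the three programs maintain and evaluate this trie. An update makes `L`
constant-time iterations. -/

/-! ### Weakest preconditions for the word RAM. -/

/-- Weakest preconditions on memory and clock, for executions that touch only cells below `S` and
hold only values up to `B`. -/
def Cmd.wp (S B : ℕ) : Cmd → ((ℕ → ℕ) → ℕ → Prop) → (ℕ → ℕ) → ℕ → Prop
  | .skip, Q, m, t => Q m t
  | .const d k, Q, m, t => d < S ∧ k ≤ B ∧ Q (Function.update m d k) (t + 1)
  | .op o d a b, Q, m, t => a < S ∧ b < S ∧ d < S ∧ o.eval (m a) (m b) ≤ B ∧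
      Q (Function.update m d (o.eval (m a) (m b))) (t + 1)
  | .load d a, Q, m, t => a < S ∧ m a < S ∧ d < S ∧ m (m a) ≤ B ∧
      Q (Function.update m d (m (m a))) (t + 1)
  | .store a b, Q, m, t => a < S ∧ b < S ∧ m a < S ∧ m b ≤ B ∧
      Q (Function.update m (m a) (m b)) (t + 1)
  | .rand d a, Q, m, t => a < S ∧ d < S ∧ ∀ v ∈ (randBelow (m a)).support,
      v ≤ B ∧ Q (Function.update m d v) (t + 1)
  | .seq p q, Q, m, t => p.wp S B (q.wp S B Q) m t
  | .ite a p q, Q, m, t => a < S ∧ (m a ≠ 0 → p.wp S B Q m (t + 1)) ∧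
      (m a = 0 → q.wp S B Q m (t + 1))
  | .loop a p, Q, m, t => a < S ∧
      ((fun (R : (ℕ → ℕ) → ℕ → Prop) m t => p.wp S B R m (t + 1))^[m a] Q) m (t + 1)

/-- All cells used lie below `S` and all values held are at most `B`. -/
def Config.Within (S B : ℕ) (s : Config) : Prop := s.cells ≤ S ∧ s.top ≤ B

/-- Statements about the support of an execution reduce to `wp`, which ignores probabilities and
treats a random draw as a universal quantifier. Since `cells` and `top` are running maxima, the
bounds at the end cover the whole execution. -/
theorem Cmd.wp_sound {S B : ℕ} (c : Cmd) :
    ∀ (Q : (ℕ → ℕ) → ℕ → Prop) (s : Config), c.wp S B Q s.mem s.time → s.Within S B →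
      ∀ u ∈ (c.exec s).support, Q u.mem u.time ∧ u.Within S B := by
  induction c with
  | skip =>
    intro Q s h hw u hu
    simp only [exec, PMF.support_pure, Set.mem_singleton_iff] at hu
    subst hu; exact ⟨h, hw⟩
  | const d k =>
    intro Q s h hw u hu
    simp only [exec, PMF.support_pure, Set.mem_singleton_iff] at hu
    subst hu
    obtain ⟨h1, h2, h3⟩ := h
    obtain ⟨w1, w2⟩ := hw
    exact ⟨h3, by simp only [Config.put, Config.tick]; omega,
      by simp only [Config.put, Config.tick]; omega⟩
  | op o d a b =>
    intro Q s h hw u hu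
    simp only [exec, PMF.support_pure, Set.mem_singleton_iff] at hu
    subst hu
    obtain ⟨h1, h2, h3, h4, h5⟩ := h
    obtain ⟨w1, w2⟩ := hw
    exact ⟨h5, by simp only [Config.put, Config.tick, Config.touch]; omega,
      by simp only [Config.put, Config.tick, Config.touch]; omega⟩
  | load d a =>
    intro Q s h hw u hu
    simp only [exec, PMF.support_pure, Set.mem_singleton_iff] at hu
    subst hu
    obtain ⟨h1, h2, h3, h4, h5⟩ := h
    obtain ⟨w1, w2⟩ := hw
    exact ⟨h5, by simp only [Config.put, Config.tick, Config.touch]; omega,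
      by simp only [Config.put, Config.tick, Config.touch]; omega⟩
  | store a b =>
    intro Q s h hw u hu
    simp only [exec, PMF.support_pure, Set.mem_singleton_iff] at hu
    subst hu
    obtain ⟨h1, h2, h3, h4, h5⟩ := h
    obtain ⟨w1, w2⟩ := hw
    exact ⟨h5, by simp only [Config.put, Config.tick, Config.touch]; omega,
      by simp only [Config.put, Config.tick, Config.touch]; omega⟩
  | rand d a =>
    intro Q s h hw u hu
    simp only [exec, PMF.support_map, Set.mem_image] at hu
    obtain ⟨v, hv, rfl⟩ := hu
    obtain ⟨h1, h2, h3⟩ := h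
    obtain ⟨h3, h4⟩ := h3 v hv
    obtain ⟨w1, w2⟩ := hw
    exact ⟨h4, by simp only [Config.put, Config.tick, Config.touch]; omega,
      by simp only [Config.put, Config.tick, Config.touch]; omega⟩
  | seq p q ihp ihq =>
    intro Q s h hw u hu
    simp only [exec, PMF.mem_support_bind_iff] at hu
    obtain ⟨v, hv, hu⟩ := hu
    obtain ⟨h1, h2⟩ := ihp _ s h hw v hv
    exact ihq _ v h1 h2 u hu
  | ite a p q ihp ihq =>
    intro Q s h hw u hu
    obtain ⟨h1, h2, h3⟩ := h
    have hw' : (s.tick.touch a).Within S B := by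
      obtain ⟨w1, w2⟩ := hw
      exact ⟨by simp only [Config.tick, Config.touch]; omega, w2⟩
    simp only [exec] at hu
    split_ifs at hu with hc
    · exact ihp Q _ (h2 hc) hw' u hu
    · exact ihq Q _ (h3 (not_not.mp hc)) hw' u hu
  | loop a p ih =>
    intro Q s h hw u hu
    obtain ⟨h1, h2⟩ := h
    have hw' : (s.tick.touch a).Within S B := by
      obtain ⟨w1, w2⟩ := hw
      exact ⟨by simp only [Config.tick, Config.touch]; omega, w2⟩
    have key : ∀ (k : ℕ) (P : PMF Config),
        (∀ v ∈ P.support, ((fun (R : (ℕ → ℕ) → ℕ → Prop) m t => p.wp S B R m (t + 1))^[k] Q)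
          v.mem v.time ∧ v.Within S B) →
        ∀ u ∈ ((fun P : PMF Config => P.bind fun t => p.exec t.tick)^[k] P).support,
          Q u.mem u.time ∧ u.Within S B := by
      intro k
      induction k with
      | zero => exact fun P hP => hP
      | succ k ihk =>
        intro P hP u hu
        -- Both iterates are unrolled at the first pass through the body: the innermost application
        -- for the distribution, the outermost one for the predicate.
        rw [Function.iterate_succ_apply] at hu
        refine ihk _ ?_ u hu
        intro v hv
        rw [PMF.mem_support_bind_iff] at hv
        obtain ⟨w, hw, hv⟩ := hv
        obtain ⟨g1, g2⟩ := hP w hw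
        rw [Function.iterate_succ_apply'] at g1
        exact ih _ w.tick g1 g2 v hv
    refine key (s.mem a) (PMF.pure (s.tick.touch a)) ?_ u hu
    intro v hv
    rw [PMF.support_pure, Set.mem_singleton_iff] at hv
    subst hv
    exact ⟨h2, hw'⟩

theorem Cmd.wp_mono {S B : ℕ} (c : Cmd) :
    ∀ (Q R : (ℕ → ℕ) → ℕ → Prop), (∀ m t, Q m t → R m t) →
      ∀ m t, c.wp S B Q m t → c.wp S B R m t := by
  induction c with
  | skip => exact fun Q R h m t hq => h _ _ hq
  | const d k => exact fun Q R h m t hq => ⟨hq.1, hq.2.1, h _ _ hq.2.2⟩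
  | op o d a b =>
    exact fun Q R h m t hq => ⟨hq.1, hq.2.1, hq.2.2.1, hq.2.2.2.1, h _ _ hq.2.2.2.2⟩
  | load d a =>
    exact fun Q R h m t hq => ⟨hq.1, hq.2.1, hq.2.2.1, hq.2.2.2.1, h _ _ hq.2.2.2.2⟩
  | store a b =>
    exact fun Q R h m t hq => ⟨hq.1, hq.2.1, hq.2.2.1, hq.2.2.2.1, h _ _ hq.2.2.2.2⟩
  | rand d a =>
    exact fun Q R h m t hq => ⟨hq.1, hq.2.1, fun v hv => ⟨(hq.2.2 v hv).1, h _ _ (hq.2.2 v hv).2⟩⟩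
  | seq p q ihp ihq => exact fun Q R h m t hq => ihp _ _ (fun m t => ihq _ _ h m t) m t hq
  | ite a p q ihp ihq =>
    exact fun Q R h m t hq => ⟨hq.1, fun hc => ihp _ _ h _ _ (hq.2.1 hc),
      fun hc => ihq _ _ h _ _ (hq.2.2 hc)⟩
  | loop a p ih =>
    intro Q R h m t hq
    refine ⟨hq.1, ?_⟩
    have key : ∀ k, ∀ m t, ((fun (R : (ℕ → ℕ) → ℕ → Prop) m t => p.wp S B R m (t + 1))^[k] Q) m t →
        ((fun (R : (ℕ → ℕ) → ℕ → Prop) m t => p.wp S B R m (t + 1))^[k] R) m t := by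
      intro k
      induction k with
      | zero => exact h
      | succ k ihk =>
        intro m t
        rw [Function.iterate_succ_apply', Function.iterate_succ_apply']
        exact ih _ _ ihk m (t + 1)
    exact key _ _ _ hq.2

theorem Cmd.wp_const {S B d k t : ℕ} {Q : (ℕ → ℕ) → ℕ → Prop} {m : ℕ → ℕ} :
    (Cmd.const d k).wp S B Q m t =
      (d < S ∧ k ≤ B ∧ Q (Function.update m d k) (t + 1)) := rfl

theorem Cmd.wp_op {S B d a b t : ℕ} {o : Op} {Q : (ℕ → ℕ) → ℕ → Prop} {m : ℕ → ℕ} :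
    (Cmd.op o d a b).wp S B Q m t = (a < S ∧ b < S ∧ d < S ∧ o.eval (m a) (m b) ≤ B ∧
      Q (Function.update m d (o.eval (m a) (m b))) (t + 1)) := rfl

/-- The invariant rule for loops. -/
theorem Cmd.wp_loop {S B a : ℕ} {p : Cmd} {Q : (ℕ → ℕ) → ℕ → Prop} {m : ℕ → ℕ} {t : ℕ}
    (I : ℕ → (ℕ → ℕ) → ℕ → Prop) (ha : a < S) (h0 : I 0 m (t + 1))
    (hstep : ∀ k, k < m a → ∀ m' t', I k m' t' → p.wp S B (I (k + 1)) m' (t' + 1))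
    (hend : ∀ m' t', I (m a) m' t' → Q m' t') :
    (Cmd.loop a p).wp S B Q m t := by
  refine ⟨ha, ?_⟩
  -- Induction on the number `k` of passes still to be made.
  have key : ∀ k, k ≤ m a → ∀ m' t', I (m a - k) m' t' →
      ((fun (R : (ℕ → ℕ) → ℕ → Prop) m t => p.wp S B R m (t + 1))^[k] Q) m' t' := by
    intro k
    induction k with
    | zero => exact fun _ => hend
    | succ k ih =>
      intro hk m' t' hI
      rw [Function.iterate_succ_apply']
      refine p.wp_mono _ _ (ih (by omega)) _ _ ?_
      have := hstep (m a - (k + 1)) (by omega) m' t' hI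
      rwa [show m a - (k + 1) + 1 = m a - k by omega] at this
  exact key (m a) le_rfl _ _ (by rwa [Nat.sub_self])

/-- Sequential composition of a list of programs. -/
def Cmd.block : List Cmd → Cmd
  | [] => .skip
  | c :: cs => .seq c (block cs)

theorem Cmd.wp_block_nil {S B : ℕ} (Q : (ℕ → ℕ) → ℕ → Prop) :
    (Cmd.block []).wp S B Q = Q := rfl

theorem Cmd.wp_block_cons {S B : ℕ} (c : Cmd) (cs : List Cmd) (Q : (ℕ → ℕ) → ℕ → Prop) :
    (Cmd.block (c :: cs)).wp S B Q = c.wp S B ((Cmd.block cs).wp S B Q) := rfl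

/-! ### Tries and their well-formedness. -/

/-- A binary trie over the universe of items, its nodes numbered in the order of their creation.
Node `i` stands for the items `x` with `x / 2 ^ lev i = pre i` and holds `cnt i y` items with
label `y`. The root is node `0`, so `child i b = 0` means that there is no such child. -/
structure Trie where
  size : ℕ
  cnt : ℕ → ℕ → ℕ
  child : ℕ → ℕ → ℕ
  lev : ℕ → ℕ
  pre : ℕ → ℕ

namespace Trie

/-- The number of items held at a node. -/
def tot (T : Trie) (i : ℕ) : ℕ := T.cnt i 0 + T.cnt i 1

/-- The least item of a node. -/
def lo (T : Trie) (i : ℕ) : ℕ := T.pre i * 2 ^ T.lev i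

/-- The end of the interval of items of a node. -/
def hi (T : Trie) (i : ℕ) : ℕ := (T.pre i + 1) * 2 ^ T.lev i

/-- Hang a new node under `p`, on side `b`. -/
def alloc (T : Trie) (p b : ℕ) : Trie where
  size := T.size + 1
  cnt := T.cnt
  child := fun i c => if i = p ∧ c = b then T.size else T.child i c
  lev := Function.update T.lev T.size (T.lev p - 1)
  pre := Function.update T.pre T.size (2 * T.pre p + b)

/-- Put an item with label `y` at node `i`. -/
def incr (T : Trie) (i y : ℕ) : Trie :=
  { T with cnt := fun k c => if k = i ∧ c = y then T.cnt k c + 1 else T.cnt k c }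

/-- The trie that consists of a root on level `L`. -/
def root (L : ℕ) : Trie where
  size := 1
  cnt := fun _ _ => 0
  child := fun _ _ => 0
  lev := fun _ => L
  pre := fun _ => 0

/-- Well-formed tries with a root on level `L`. -/
structure WF (L : ℕ) (T : Trie) : Prop where
  size_pos : 0 < T.size
  lev_root : T.lev 0 = L
  fresh_cnt : ∀ i, T.size ≤ i → ∀ y, T.cnt i y = 0
  fresh_child : ∀ i, T.size ≤ i → ∀ b, T.child i b = 0
  child_spec : ∀ i < T.size, ∀ b < 2, T.child i b ≠ 0 → T.child i b < T.size ∧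
    T.lev (T.child i b) + 1 = T.lev i ∧ T.pre (T.child i b) = 2 * T.pre i + b
  parent : ∀ c, 0 < c → c < T.size → ∃ i < T.size, ∃ b < 2, T.child i b = c
  inj : ∀ i < T.size, ∀ k < T.size, T.lev i = T.lev k → T.pre i = T.pre k → i = k
  lev_le : ∀ i < T.size, T.lev i ≤ L
  hi_le : ∀ i < T.size, T.hi i ≤ 2 ^ L

theorem WF.root (L : ℕ) : (root L).WF L where
  size_pos := Nat.one_pos
  lev_root := rfl
  fresh_cnt := fun _ _ _ => rfl
  fresh_child := fun _ _ _ => rfl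
  child_spec := fun _ _ _ _ h => absurd rfl h
  parent := fun c h1 h2 => by simp only [Trie.root] at h2; omega
  inj := fun i hi k hk _ _ => by simp only [Trie.root] at hi hk; omega
  lev_le := fun _ _ => le_rfl
  hi_le := fun _ _ => by simp [hi, Trie.root]

theorem WF.incr {L : ℕ} {T : Trie} (h : T.WF L) {i : ℕ} (hi : i < T.size) (y : ℕ) :
    (T.incr i y).WF L :=
  { h with
    fresh_cnt := fun k hk c => by
      have hk' : T.size ≤ k := hk
      simp only [Trie.incr]
      rw [if_neg (by omega), h.fresh_cnt k hk'] }

/-- The point is that no two nodes stand for the same dyadic interval. An old node with the interval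
of the new one would have a parent with the interval of `p`, hence equal to `p`, and the slot `b` of
`p` would be occupied. -/
theorem WF.alloc {L : ℕ} {T : Trie} (h : T.WF L) {p b : ℕ} (hp : p < T.size) (hb : b < 2)
    (hl : T.lev p ≠ 0) (hc : T.child p b = 0) : (T.alloc p b).WF L := by
  have lev_old : ∀ i < T.size, (T.alloc p b).lev i = T.lev i := fun i hi =>
    Function.update_of_ne hi.ne _ _
  have pre_old : ∀ i < T.size, (T.alloc p b).pre i = T.pre i := fun i hi =>
    Function.update_of_ne hi.ne _ _
  have lev_new : (T.alloc p b).lev T.size = T.lev p - 1 := Function.update_self ..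
  have pre_new : (T.alloc p b).pre T.size = 2 * T.pre p + b := Function.update_self ..
  have lp := h.lev_le p hp
  have key : ∀ i < T.size, T.lev i = T.lev p - 1 → T.pre i ≠ 2 * T.pre p + b := by
    intro i hi h1 h2
    have hi0 : i ≠ 0 := by
      rintro rfl
      rw [h.lev_root] at h1
      omega
    obtain ⟨q, hq, b', hb', hqi⟩ := h.parent i (by omega) hi
    obtain ⟨-, g2, g3⟩ := h.child_spec q hq b' hb' (by omega)
    rw [hqi] at g2 g3
    have hqp : q = p := h.inj q hq p hp (by omega) (by omega)
    subst hqp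
    have : b' = b := by omega
    subst this
    omega
  refine ⟨Nat.succ_pos _, ?_, ?_, ?_, ?_, ?_, ?_, ?_, ?_⟩
  · rw [lev_old 0 h.size_pos, h.lev_root]
  · intro i hi y
    exact h.fresh_cnt i (le_trans (Nat.le_succ _) hi) y
  · intro i hi c
    have hi' : T.size + 1 ≤ i := hi
    simp only [Trie.alloc]
    rw [if_neg (by omega), h.fresh_child i (by omega)]
  · intro i hi c hc2 hne
    have hi' : i < T.size + 1 := hi
    have hs : (T.alloc p b).size = T.size + 1 := rfl
    by_cases hic : i = p ∧ c = b
    · obtain ⟨rfl, rfl⟩ := hic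
      have : (T.alloc i c).child i c = T.size := if_pos ⟨rfl, rfl⟩
      rw [this, lev_new, pre_new, lev_old i hp, pre_old i hp, hs]
      exact ⟨by omega, by omega, rfl⟩
    · have e : (T.alloc p b).child i c = T.child i c := if_neg hic
      rw [e] at hne ⊢
      have hi2 : i < T.size := by
        by_contra hcon
        exact hne (h.fresh_child i (by omega) c)
      obtain ⟨g1, g2, g3⟩ := h.child_spec i hi2 c hc2 hne
      rw [lev_old _ g1, pre_old _ g1, lev_old i hi2, pre_old i hi2, hs]
      exact ⟨by omega, g2, g3⟩
  · intro c h0 hcs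
    have hcs' : c < T.size + 1 := hcs
    by_cases hcn : c = T.size
    · exact ⟨p, Nat.lt_succ_of_lt hp, b, hb, by rw [hcn]; exact if_pos ⟨rfl, rfl⟩⟩
    · obtain ⟨i, hi, b', hb', e⟩ := h.parent c h0 (by omega)
      refine ⟨i, Nat.lt_succ_of_lt hi, b', hb', ?_⟩
      rw [← e]
      refine if_neg ?_
      rintro ⟨rfl, rfl⟩
      omega
  · intro i hi k hk e1 e2
    have hi' : i < T.size + 1 := hi
    have hk' : k < T.size + 1 := hk
    rcases Nat.lt_succ_iff_lt_or_eq.mp hi' with hi2 | rfl <;>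
      rcases Nat.lt_succ_iff_lt_or_eq.mp hk' with hk2 | rfl
    · rw [lev_old _ hi2, lev_old _ hk2] at e1
      rw [pre_old _ hi2, pre_old _ hk2] at e2
      exact h.inj i hi2 k hk2 e1 e2
    · rw [lev_old _ hi2, lev_new] at e1
      rw [pre_old _ hi2, pre_new] at e2
      exact absurd e2 (key i hi2 e1)
    · rw [lev_old _ hk2, lev_new] at e1
      rw [pre_old _ hk2, pre_new] at e2
      exact absurd e2.symm (key k hk2 e1.symm)
    · rfl
  · intro i hi
    rcases Nat.lt_succ_iff_lt_or_eq.mp (show i < T.size + 1 from hi) with hi2 | rfl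
    · rw [lev_old _ hi2]; exact h.lev_le i hi2
    · rw [lev_new]; omega
  · intro i hi
    rcases Nat.lt_succ_iff_lt_or_eq.mp (show i < T.size + 1 from hi) with hi2 | rfl
    · rw [Trie.hi, lev_old _ hi2, pre_old _ hi2]; exact h.hi_le i hi2
    · rw [Trie.hi, lev_new, pre_new]
      refine le_trans ?_ (h.hi_le p hp)
      rw [Trie.hi]
      obtain ⟨l, hl'⟩ := Nat.exists_eq_succ_of_ne_zero hl
      rw [hl', Nat.succ_sub_one, pow_succ]
      calc (2 * T.pre p + b + 1) * 2 ^ l ≤ (2 * T.pre p + 2) * 2 ^ l :=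
            Nat.mul_le_mul_right _ (by omega)
        _ = (T.pre p + 1) * (2 ^ l * 2) := by ring

/-! ### The cap on the number of items at inner nodes. -/

/-- A node above the leaves holds at most `t / K` items. -/
def Capped (K t : ℕ) (T : Trie) : Prop :=
  ∀ i < T.size, T.lev i ≠ 0 → T.tot i * K ≤ t

theorem Capped.mono {K t t' : ℕ} {T : Trie} (h : T.Capped K t) (ht : t ≤ t') : T.Capped K t' :=
  fun i hi hl => (h i hi hl).trans ht

theorem Capped.root (K t L : ℕ) : (root L).Capped K t := by
  intro i _ _
  simp [tot, Trie.root]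

theorem Capped.alloc {K t L : ℕ} {T : Trie} (h : T.Capped K t) (hT : T.WF L) (p b : ℕ) :
    (T.alloc p b).Capped K t := by
  intro i hi hl
  rcases Nat.lt_succ_iff_lt_or_eq.mp (show i < T.size + 1 from hi) with hi2 | rfl
  · refine h i hi2 ?_
    rwa [show (T.alloc p b).lev i = T.lev i from Function.update_of_ne hi2.ne _ _] at hl
  · have : (T.alloc p b).tot T.size = 0 := by
      simp only [tot, Trie.alloc, hT.fresh_cnt _ le_rfl]
    simp [this]

theorem tot_incr {T : Trie} {i y : ℕ} (hy : y < 2) (k : ℕ) :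
    (T.incr i y).tot k = if k = i then T.tot k + 1 else T.tot k := by
  simp only [tot, incr]
  have : y = 0 ∨ y = 1 := by omega
  by_cases hk : k = i <;> rcases this with rfl | rfl <;> simp [hk] <;> omega

theorem Capped.incr {K t : ℕ} {T : Trie} (h : T.Capped K t) {i y : ℕ} (hy : y < 2)
    (hi : T.lev i = 0 ∨ (T.tot i + 1) * K ≤ t) : (T.incr i y).Capped K t := by
  intro k hk hl
  rw [tot_incr hy]
  split_ifs with e
  · subst e
    exact hi.resolve_left hl
  · exact h k hk hl

/-! ### The credit argument that bounds the number of nodes. -/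

/-- The number of children of a node. -/
def numChildren (T : Trie) (i : ℕ) : ℕ :=
  (if T.child i 0 = 0 then 0 else 1) + (if T.child i 1 = 0 then 0 else 1)

/-- A distribution of a total credit of at most `H` to the nodes, which pays for their children. -/
def Credit (K t : ℕ) (H : ℝ) (T : Trie) : Prop :=
  ∃ W : ℕ → ℝ, (∀ i, 0 ≤ W i) ∧ W T.size = 0 ∧ (∀ i < T.size, (T.tot i : ℝ) ≤ W i * t) ∧
    (∀ i < T.size, (T.numChildren i : ℝ) ≤ 2 * K * W i) ∧
    T.size = 1 + ∑ i ∈ Finset.range T.size, T.numChildren i ∧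
    ∑ i ∈ Finset.range T.size, W i ≤ H

theorem Credit.root (K t L : ℕ) : (root L).Credit K t 0 :=
  ⟨fun _ => 0, fun _ => le_rfl, rfl, fun i _ => by simp [tot, Trie.root],
    fun i _ => by simp [numChildren, Trie.root], by simp [numChildren, Trie.root], by simp⟩

/-- Credit already given never has to be renewed, because `W i * t` only grows with time. This is
why the total is a harmonic sum. -/
theorem Credit.mono {K t t' : ℕ} {H H' : ℝ} {T : Trie} (h : T.Credit K t H) (ht : t ≤ t')
    (hH : H ≤ H') : T.Credit K t' H' := by
  obtain ⟨W, h0, hW, h1, h2, h3, h4⟩ := h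
  refine ⟨W, h0, hW, fun i hi => (h1 i hi).trans ?_, h2, h3, h4.trans hH⟩
  exact mul_le_mul_of_nonneg_left (by exact_mod_cast ht) (h0 i)

theorem Credit.incr {K t : ℕ} {H : ℝ} {T : Trie} (h : T.Credit K t H) (ht : 0 < t) {i y : ℕ}
    (hi : i < T.size) (hy : y < 2) : (T.incr i y).Credit K t (H + 1 / t) := by
  obtain ⟨W, h0, hW, h1, h2, h3, h4⟩ := h
  have ht' : (0 : ℝ) < t := by exact_mod_cast ht
  have hp : (0 : ℝ) < 1 / t := by positivity
  -- The node that receives the item gets `1 / t`, which makes up for the new item in `tot ≤ W * t`.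
  refine ⟨fun k => W k + if k = i then (1 : ℝ) / t else 0, ?_, ?_, ?_, ?_, h3, ?_⟩
  · intro k
    have := h0 k
    dsimp only
    split_ifs <;> linarith
  · have : T.size ≠ i := hi.ne'
    change W T.size + (if T.size = i then (1 : ℝ) / t else 0) = 0
    rw [if_neg this, hW, add_zero]
  · intro k hk
    have := h1 k hk
    rw [tot_incr hy]
    by_cases e : k = i
    · simp only [if_pos e, Nat.cast_add, Nat.cast_one, add_mul]
      rw [one_div_mul_cancel ht'.ne']
      linarith
    · simp only [if_neg e, add_zero]
      exact this
  · intro k hk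
    refine (h2 k hk).trans (mul_le_mul_of_nonneg_left ?_ (by positivity))
    dsimp only
    split_ifs <;> linarith
  · change ∑ k ∈ Finset.range T.size, _ ≤ _
    rw [Finset.sum_add_distrib, Finset.sum_ite_eq', if_pos (Finset.mem_range.mpr hi)]
    exact add_le_add_left h4 _

/-- The deposit `1 / t` goes to the parent. With it the parent's credit is at least `(tot + 1) / t >
1 / K`, so `2 * K * W` exceeds `2`, the largest possible number of children. -/
theorem Credit.alloc {K t L : ℕ} {H : ℝ} {T : Trie} (h : T.Credit K t H) (hT : T.WF L)
    (ht : 0 < t) {p b : ℕ} (hp : p < T.size) (hb : b < 2) (hc : T.child p b = 0)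
    (hK : t < (T.tot p + 1) * K) : (T.alloc p b).Credit K t (H + 1 / t) := by
  obtain ⟨W, h0, hW, h1, h2, h3, h4⟩ := h
  have ht' : (0 : ℝ) < t := by exact_mod_cast ht
  have hinv : (0 : ℝ) < 1 / t := by positivity
  have hs : T.size ≠ 0 := hT.size_pos.ne'
  have hnum : ∀ k ≠ p, (T.alloc p b).numChildren k = T.numChildren k := by
    intro k hk
    simp [numChildren, Trie.alloc, hk]
  have hnump : (T.alloc p b).numChildren p = T.numChildren p + 1 := by
    have : b = 0 ∨ b = 1 := by omega
    rcases this with rfl | rfl <;> simp [numChildren, Trie.alloc, hs, hc, Nat.add_comm]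
  have hfresh : T.numChildren T.size = 0 := by
    simp [numChildren, hT.fresh_child _ le_rfl]
  -- The new node `T.size` starts with credit zero by the clause `W T.size = 0`; the value at
  -- `T.size + 1` is reset so that this clause holds again.
  refine ⟨fun k => if k = T.size + 1 then 0 else W k + if k = p then (1 : ℝ) / t else 0,
    ?_, ?_, ?_, ?_, ?_, ?_⟩
  · intro k
    have := h0 k
    dsimp only
    split_ifs <;> linarith
  · exact if_pos rfl
  · intro k hk
    have hk' : k < T.size + 1 := hk
    dsimp only
    rw [if_neg (by omega)]
    rcases Nat.lt_succ_iff_lt_or_eq.mp hk' with hk2 | rfl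
    · refine (h1 k hk2).trans (mul_le_mul_of_nonneg_right ?_ ht'.le)
      split_ifs <;> linarith
    · have : (T.alloc p b).tot T.size = 0 := by
        simp only [tot, Trie.alloc, hT.fresh_cnt _ le_rfl]
      rw [this, if_neg (by omega), hW]
      simp
  · intro k hk
    have hk' : k < T.size + 1 := hk
    dsimp only
    rw [if_neg (by omega)]
    by_cases e : k = p
    · subst e
      rw [if_pos rfl]
      have hle : (T.alloc k b).numChildren k ≤ 2 := by
        simp only [numChildren]
        split_ifs <;> omega
      have g1 := h1 k hp
      have g2 : (t : ℝ) < (T.tot k + 1) * K := by exact_mod_cast hK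
      have g3 : (T.tot k + 1 : ℝ) ≤ (W k + 1 / t) * t := by
        rw [add_mul, one_div_mul_cancel ht'.ne']; linarith
      have g4 : (t : ℝ) * 1 < t * (K * (W k + 1 / t)) := by
        calc (t : ℝ) * 1 = t := mul_one _
          _ < (T.tot k + 1) * K := g2
          _ ≤ (W k + 1 / t) * t * K := mul_le_mul_of_nonneg_right g3 (by positivity)
          _ = t * (K * (W k + 1 / t)) := by ring
      have g5 := lt_of_mul_lt_mul_left g4 ht'.le
      have g6 : (((T.alloc k b).numChildren k : ℕ) : ℝ) ≤ 2 := by exact_mod_cast hle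
      linarith
    · rw [if_neg e, add_zero, hnum k e]
      rcases Nat.lt_succ_iff_lt_or_eq.mp hk' with hk2 | rfl
      · exact h2 k hk2
      · rw [hfresh, hW]; simp
  · have : ∀ k ∈ Finset.range (T.size + 1),
        (T.alloc p b).numChildren k = T.numChildren k + if k = p then 1 else 0 := by
      intro k _
      by_cases e : k = p
      · rw [if_pos e, e, hnump]
      · rw [if_neg e, hnum k e, add_zero]
    change T.size + 1 = 1 + ∑ i ∈ Finset.range (T.size + 1), (T.alloc p b).numChildren i
    rw [Finset.sum_congr rfl this, Finset.sum_add_distrib, Finset.sum_ite_eq',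
      if_pos (Finset.mem_range.mpr (by omega)), Finset.sum_range_succ, hfresh]
    omega
  · change ∑ i ∈ Finset.range (T.size + 1), _ ≤ _
    have : ∀ k ∈ Finset.range (T.size + 1),
        (if k = T.size + 1 then 0 else W k + if k = p then (1 : ℝ) / t else 0) =
          W k + if k = p then (1 : ℝ) / t else 0 := by
      intro k hk
      rw [if_neg (by have := Finset.mem_range.mp hk; omega)]
    rw [Finset.sum_congr rfl this, Finset.sum_add_distrib, Finset.sum_ite_eq',
      if_pos (Finset.mem_range.mpr (by omega)), Finset.sum_range_succ, hW, add_zero]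
    exact add_le_add_left h4 _

/-- Every node but the root is counted as a child of some node, and the children are paid for by the
credit. -/
theorem Credit.size_le {K t : ℕ} {H : ℝ} {T : Trie} (h : T.Credit K t H) :
    (T.size : ℝ) ≤ 1 + 2 * K * H := by
  obtain ⟨W, h0, hW, h1, h2, h3, h4⟩ := h
  have : (∑ i ∈ Finset.range T.size, (T.numChildren i : ℝ)) ≤
      ∑ i ∈ Finset.range T.size, 2 * K * W i :=
    Finset.sum_le_sum fun i hi => h2 i (Finset.mem_range.mp hi)
  rw [← Finset.mul_sum] at this
  have e : (T.size : ℝ) = 1 + ∑ i ∈ Finset.range T.size, (T.numChildren i : ℝ) := by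
    exact_mod_cast h3
  have := mul_le_mul_of_nonneg_left h4 (show (0 : ℝ) ≤ 2 * K by positivity)
  linarith

/-! ### Items whose side of a split is uncertain. -/

/-- The items with label `y` held at nodes whose interval lies below `j + 1`. -/
def below (T : Trie) (j y : ℕ) : ℕ :=
  ∑ i ∈ Finset.range T.size, if T.hi i ≤ j + 1 then T.cnt i y else 0

/-- The items with label `y` held at nodes whose interval contains `j` and `j + 1`. -/
def across (T : Trie) (j y : ℕ) : ℕ :=
  ∑ i ∈ Finset.range T.size, if T.lo i ≤ j ∧ j + 1 < T.hi i then T.cnt i y else 0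

theorem below_alloc {L : ℕ} {T : Trie} (hT : T.WF L) (p b j y : ℕ) :
    (T.alloc p b).below j y = T.below j y := by
  change ∑ i ∈ Finset.range (T.size + 1), _ = _
  rw [Finset.sum_range_succ]
  simp only [Trie.alloc, hT.fresh_cnt _ le_rfl, ite_self, add_zero]
  refine Finset.sum_congr rfl fun i hi => ?_
  simp only [Function.update_of_ne (Finset.mem_range.mp hi).ne, Trie.hi]
  exact if_congr Iff.rfl rfl rfl

theorem across_alloc {L : ℕ} {T : Trie} (hT : T.WF L) (p b j y : ℕ) :
    (T.alloc p b).across j y = T.across j y := by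
  change ∑ i ∈ Finset.range (T.size + 1), _ = _
  rw [Finset.sum_range_succ]
  simp only [Trie.alloc, hT.fresh_cnt _ le_rfl, ite_self, add_zero]
  refine Finset.sum_congr rfl fun i hi => ?_
  simp only [Function.update_of_ne (Finset.mem_range.mp hi).ne, Trie.hi, Trie.lo]
  exact if_congr Iff.rfl rfl rfl

theorem sum_incr {T : Trie} {i : ℕ} (hi : i < T.size) (P : ℕ → Prop) [DecidablePred P] (z y : ℕ) :
    ∑ k ∈ Finset.range T.size, (if P k then (T.incr i z).cnt k y else 0) =
      (∑ k ∈ Finset.range T.size, if P k then T.cnt k y else 0) +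
        if P i ∧ y = z then 1 else 0 := by
  have : ∀ k ∈ Finset.range T.size, (if P k then (T.incr i z).cnt k y else 0) =
      (if P k then T.cnt k y else 0) + if k = i then (if P i ∧ y = z then 1 else 0) else 0 := by
    intro k _
    simp only [Trie.incr]
    by_cases e : k = i
    · subst e
      by_cases h1 : P k <;> by_cases h2 : y = z <;> simp [h1, h2]
    · simp [e]
  rw [Finset.sum_congr rfl this, Finset.sum_add_distrib, Finset.sum_ite_eq',
    if_pos (Finset.mem_range.mpr hi)]

/-- A node across the split has level at least `1`, since a leaf interval contains a single item.
Its prefix is determined by its level and `j`, so there is at most one on each level, and each holds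
at most `t / K` items. -/
theorem across_le {K t L : ℕ} {T : Trie} (hT : T.WF L) (hC : T.Capped K t) (j : ℕ) :
    (T.across j 0 + T.across j 1) * K ≤ L * t := by
  classical
  set s := (Finset.range T.size).filter fun i => T.lo i ≤ j ∧ j + 1 < T.hi i with hs
  have hlev : ∀ i ∈ s, T.lev i ≠ 0 := by
    intro i hi h0
    rw [hs, Finset.mem_filter] at hi
    simp only [lo, Trie.hi, h0, pow_zero, mul_one] at hi
    omega
  have hcard : s.card ≤ L := by
    have : s.card ≤ (Finset.Icc 1 L).card := by
      refine Finset.card_le_card_of_injOn T.lev ?_ ?_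
      · intro i hi
        have h1 := hlev i hi
        have h2 := hT.lev_le i (Finset.mem_range.mp (Finset.mem_filter.mp hi).1)
        simp only [Finset.coe_Icc, Set.mem_Icc]
        omega
      · intro i hi k hk e
        -- The interval contains `j`, so its prefix is the leading part of `j`.
        have hpre : ∀ q ∈ s, T.pre q = j / 2 ^ T.lev q := by
          intro q hq
          obtain ⟨-, h1, h2⟩ := Finset.mem_filter.mp hq
          rw [lo] at h1
          rw [Trie.hi] at h2
          symm
          rw [Nat.div_eq_iff (by positivity)]
          constructor
          · exact h1
          · rw [add_mul, one_mul] at h2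
            omega
        exact hT.inj i (Finset.mem_range.mp (Finset.mem_filter.mp hi).1) k
          (Finset.mem_range.mp (Finset.mem_filter.mp hk).1) e
          (by rw [hpre i hi, hpre k hk, e])
    simpa using this
  have e : T.across j 0 + T.across j 1 = ∑ i ∈ s, T.tot i := by
    rw [across, across, ← Finset.sum_filter, ← Finset.sum_filter, ← Finset.sum_add_distrib]
    rfl
  rw [e, Finset.sum_mul]
  calc ∑ i ∈ s, T.tot i * K ≤ ∑ _i ∈ s, t := Finset.sum_le_sum fun i hi =>
        hC i (Finset.mem_range.mp (Finset.mem_filter.mp hi).1) (hlev i hi)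
    _ = s.card * t := by simp
    _ ≤ L * t := Nat.mul_le_mul_right _ hcard

end Trie

/-- The number of items with label `y` in the left part of the split `j`. -/
def leftCount (σ : List (ℕ × ℤˣ)) (j y : ℕ) : ℕ :=
  σ.countP fun p => p.1 ≤ j ∧ StreamAlg.encode p.2 = y

/-- The trie accounts for the stream: only items held at nodes across a split are misplaced. -/
def Trie.Counts (T : Trie) (σ : List (ℕ × ℤˣ)) : Prop :=
  ∀ j y, T.below j y ≤ leftCount σ j y ∧ leftCount σ j y ≤ T.below j y + T.across j y

theorem Trie.Counts.root (L : ℕ) : (Trie.root L).Counts [] := by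
  intro j y
  have h1 : (Trie.root L).below j y = 0 := Finset.sum_eq_zero fun i _ => ite_self _
  have h2 : (Trie.root L).across j y = 0 := Finset.sum_eq_zero fun i _ => ite_self _
  simp [leftCount, h1, h2]

theorem Trie.Counts.alloc {L : ℕ} {T : Trie} {σ : List (ℕ × ℤˣ)} (h : T.Counts σ) (hT : T.WF L)
    (p b : ℕ) : (T.alloc p b).Counts σ := by
  intro j y
  rw [below_alloc hT, across_alloc hT]
  exact h j y

/-- The item lies in the interval of the node that holds it. An interval ending at or before `j + 1`
puts it on the left, an interval starting after `j` puts it on the right, and otherwise it is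
counted by `across`. -/
theorem Trie.Counts.incr {T : Trie} {σ : List (ℕ × ℤˣ)} (h : T.Counts σ) {i : ℕ}
    (hi : i < T.size) (p : ℕ × ℤˣ) (hp : p.1 / 2 ^ T.lev i = T.pre i) :
    (T.incr i (StreamAlg.encode p.2)).Counts (σ ++ [p]) := by
  intro j y
  obtain ⟨h1, h2⟩ := h j y
  have e1 := sum_incr hi (fun k => T.hi k ≤ j + 1) (StreamAlg.encode p.2) y
  have e2 := sum_incr hi (fun k => T.lo k ≤ j ∧ j + 1 < T.hi k) (StreamAlg.encode p.2) y
  change (T.incr i _).below j y = T.below j y + _ at e1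
  change (T.incr i _).across j y = T.across j y + _ at e2
  have e3 : leftCount (σ ++ [p]) j y =
      leftCount σ j y + if p.1 ≤ j ∧ StreamAlg.encode p.2 = y then 1 else 0 := by
    simp [leftCount, List.countP_append, List.countP_cons]
  have hlo : T.lo i ≤ p.1 := by
    rw [lo, ← hp]; exact Nat.div_mul_le_self _ _
  have hhi : p.1 < T.hi i := by
    rw [Trie.hi, ← hp, mul_comm]
    exact Nat.lt_mul_div_succ _ (by positivity)
  rw [e1, e2, e3]
  by_cases hy : y = StreamAlg.encode p.2
  · simp only [hy, and_true] at h1 h2 ⊢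
    split_ifs <;> omega
  · have hy' : ¬ StreamAlg.encode p.2 = y := fun e => hy e.symm
    simp only [hy, hy', and_false, if_false, add_zero]
    exact ⟨h1, h2⟩

/-! ### The layout of the trie in memory. -/

/-- The content of memory between items: cell `4` counts the items, cell `13` those with label
`1`, and node `i` of the trie occupies the cells from `5 * (i + 8)` on: its number of items, its
number of items with label `1`, its two children, and the end of its interval. Cell `8` holds the
address of the last node. -/
structure Machine (N E L t P : ℕ) (T : Trie) (m : ℕ → ℕ) : Prop where
  cell0 : m 0 = N
  cell1 : m 1 = E
  cell4 : m 4 = t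
  cell5 : m 5 = L
  cell6 : m 6 = 2 ^ L
  cell7 : m 7 = L * 16 * E
  cell8 : m 8 = 5 * (T.size + 7)
  cell13 : m 13 = P
  tot : ∀ i < T.size, m (5 * (i + 8)) = T.tot i
  pos : ∀ i < T.size, m (5 * (i + 8) + 1) = T.cnt i 1
  child : ∀ i < T.size, ∀ b < 2, m (5 * (i + 8) + 2 + b) =
    if T.child i b = 0 then 0 else 5 * (T.child i b + 8)
  hi : ∀ i < T.size, m (5 * (i + 8) + 4) = T.hi i
  fresh : ∀ a, 5 * (T.size + 8) ≤ a → m a = 0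

namespace Machine

variable {N E L t P : ℕ} {T : Trie} {m : ℕ → ℕ}

theorem scratch (h : Machine N E L t P T m) {d : ℕ}
    (hd : d = 2 ∨ d = 3 ∨ 9 ≤ d ∧ d < 13 ∨ 14 ≤ d ∧ d < 40) (v : ℕ) :
    Machine N E L t P T (Function.update m d v) := by
  have key : ∀ a, a ≠ d → Function.update m d v a = m a := fun a ha => Function.update_of_ne ha _ _
  constructor
  · rw [key _ (by omega), h.cell0]
  · rw [key _ (by omega), h.cell1]
  · rw [key _ (by omega), h.cell4]
  · rw [key _ (by omega), h.cell5]
  · rw [key _ (by omega), h.cell6]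
  · rw [key _ (by omega), h.cell7]
  · rw [key _ (by omega), h.cell8]
  · rw [key _ (by omega), h.cell13]
  · intro i hi; rw [key _ (by omega), h.tot i hi]
  · intro i hi; rw [key _ (by omega), h.pos i hi]
  · intro i hi b hb; rw [key _ (by omega), h.child i hi b hb]
  · intro i hi; rw [key _ (by omega), h.hi i hi]
  · intro a ha; rw [key _ (by omega), h.fresh a ha]

/-- Only the last-node pointer, the parent's child slot and the end of the new interval need to be
written: unused cells are zero, which is right for the counters and child slots of a new node. -/
theorem alloc (h : Machine N E L t P T m) (hT : T.WF L) {i b : ℕ} (hi : i < T.size) (hb : b < 2)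
    {m' : ℕ → ℕ} (h8 : m' 8 = 5 * (T.size + 8))
    (hchild : m' (5 * (i + 8) + 2 + b) = 5 * (T.size + 8))
    (hend : m' (5 * (T.size + 8) + 4) = (2 * T.pre i + b + 1) * 2 ^ (T.lev i - 1))
    (hother : ∀ a, a < 8 ∨ a = 13 ∨ 40 ≤ a → a ≠ 5 * (i + 8) + 2 + b →
      a ≠ 5 * (T.size + 8) + 4 → m' a = m a) :
    Machine N E L t P (T.alloc i b) m' := by
  have lev_old : ∀ k < T.size, (T.alloc i b).lev k = T.lev k := fun k hk =>
    Function.update_of_ne hk.ne _ _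
  have pre_old : ∀ k < T.size, (T.alloc i b).pre k = T.pre k := fun k hk =>
    Function.update_of_ne hk.ne _ _
  have lev_new : (T.alloc i b).lev T.size = T.lev i - 1 := Function.update_self ..
  have pre_new : (T.alloc i b).pre T.size = 2 * T.pre i + b := Function.update_self ..
  have hcases : ∀ k < (T.alloc i b).size, k < T.size ∨ k = T.size := fun k hk =>
    Nat.lt_succ_iff_lt_or_eq.mp hk
  have hsize := hT.size_pos
  constructor
  · rw [hother _ (by omega) (by omega) (by omega), h.cell0]
  · rw [hother _ (by omega) (by omega) (by omega), h.cell1]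
  · rw [hother _ (by omega) (by omega) (by omega), h.cell4]
  · rw [hother _ (by omega) (by omega) (by omega), h.cell5]
  · rw [hother _ (by omega) (by omega) (by omega), h.cell6]
  · rw [hother _ (by omega) (by omega) (by omega), h.cell7]
  · exact h8
  · rw [hother _ (by omega) (by omega) (by omega), h.cell13]
  · intro k hk
    rw [hother _ (by omega) (by omega) (by omega)]
    rcases hcases k hk with hk | rfl
    · exact h.tot k hk
    · rw [h.fresh _ le_rfl]
      simp only [Trie.tot, Trie.alloc, hT.fresh_cnt _ le_rfl]
  · intro k hk
    rw [hother _ (by omega) (by omega) (by omega)]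
    rcases hcases k hk with hk | rfl
    · exact h.pos k hk
    · rw [h.fresh _ (by omega)]
      simp only [Trie.alloc, hT.fresh_cnt _ le_rfl]
  · intro k hk c hc
    by_cases e : k = i ∧ c = b
    · obtain ⟨rfl, rfl⟩ := e
      have : (T.alloc k c).child k c = T.size := if_pos ⟨rfl, rfl⟩
      rw [hchild, this, if_neg (by omega)]
    · have : (T.alloc i b).child k c = T.child k c := if_neg e
      rw [hother _ (by omega) (by omega) (by omega), this]
      rcases hcases k hk with hk | rfl
      · exact h.child k hk c hc
      · rw [h.fresh _ (by omega), hT.fresh_child _ le_rfl, if_pos rfl]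
  · intro k hk
    rcases hcases k hk with hk | rfl
    · rw [hother _ (by omega) (by omega) (by omega), h.hi k hk, Trie.hi, Trie.hi, lev_old k hk,
        pre_old k hk]
    · rw [hend, Trie.hi, lev_new, pre_new]
  · intro a ha
    have ha' : 5 * (T.size + 1 + 8) ≤ a := ha
    rw [hother _ (by omega) (by omega) (by omega), h.fresh _ (by omega)]

theorem incr (h : Machine N E L t P T m) {i y : ℕ} (hi : i < T.size) (hy : y < 2)
    {m' : ℕ → ℕ} (htot : m' (5 * (i + 8)) = T.tot i + 1)
    (hpos : m' (5 * (i + 8) + 1) = T.cnt i 1 + y)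
    (hother : ∀ a, a < 9 ∨ a = 13 ∨ 40 ≤ a → a ≠ 5 * (i + 8) → a ≠ 5 * (i + 8) + 1 →
      m' a = m a) :
    Machine N E L t P (T.incr i y) m' := by
  constructor
  · rw [hother _ (by omega) (by omega) (by omega), h.cell0]
  · rw [hother _ (by omega) (by omega) (by omega), h.cell1]
  · rw [hother _ (by omega) (by omega) (by omega), h.cell4]
  · rw [hother _ (by omega) (by omega) (by omega), h.cell5]
  · rw [hother _ (by omega) (by omega) (by omega), h.cell6]
  · rw [hother _ (by omega) (by omega) (by omega), h.cell7]
  · rw [hother _ (by omega) (by omega) (by omega), h.cell8]; rfl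
  · rw [hother _ (by omega) (by omega) (by omega), h.cell13]
  · intro k hk
    rw [Trie.tot_incr hy]
    split_ifs with e
    · rw [e, htot]
    · rw [hother _ (by omega) (by omega) (by omega), h.tot k hk]
  · intro k hk
    by_cases e : k = i
    · subst e
      have : y = 0 ∨ y = 1 := by omega
      rcases this with rfl | rfl <;> simp [hpos, Trie.incr]
    · rw [hother _ (by omega) (by omega) (by omega), h.pos k hk]
      simp [Trie.incr, e]
  · intro k hk c hc
    rw [hother _ (by omega) (by omega) (by omega)]
    exact h.child k hk c hc
  · intro k hk
    rw [hother _ (by omega) (by omega) (by omega)]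
    exact h.hi k hk
  · intro a ha
    have ha' : 5 * (T.size + 8) ≤ a := ha
    rw [hother _ (by omega) (by omega) (by omega), h.fresh a ha']

theorem count (h : Machine N E L t P T m) {t' P' : ℕ} :
    Machine N E L t' P' T (Function.update (Function.update m 4 t') 13 P') := by
  have key : ∀ a, a ≠ 4 → a ≠ 13 →
      Function.update (Function.update m 4 t') 13 P' a = m a := fun a h1 h2 => by
    rw [Function.update_of_ne h2, Function.update_of_ne h1]
  constructor
  · rw [key _ (by omega) (by omega), h.cell0]
  · rw [key _ (by omega) (by omega), h.cell1]
  · rfl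
  · rw [key _ (by omega) (by omega), h.cell5]
  · rw [key _ (by omega) (by omega), h.cell6]
  · rw [key _ (by omega) (by omega), h.cell7]
  · rw [key _ (by omega) (by omega), h.cell8]
  · rfl
  · intro i hi; rw [key _ (by omega) (by omega), h.tot i hi]
  · intro i hi; rw [key _ (by omega) (by omega), h.pos i hi]
  · intro i hi b hb; rw [key _ (by omega) (by omega), h.child i hi b hb]
  · intro i hi; rw [key _ (by omega) (by omega), h.hi i hi]
  · intro a ha; rw [key _ (by omega) (by omega), h.fresh a ha]

end Machine

/-! ### The update program. -/

/-- Move from the node at the address in cell `9` to its child that contains the item in cell `2`;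
create the child if there is none. Cell `11` holds the length of the interval of the node. -/
def descend : Cmd := .block
  [.const 20 2, .op .div 11 11 20, .op .div 21 2 11, .op .mod 22 21 20, .op .add 22 22 20,
    .op .add 22 9 22, .load 23 22,
    .ite 23 .skip (.block
      [.const 20 5, .op .add 8 8 20, .store 22 8, .const 20 1, .op .add 21 21 20,
        .op .mul 21 21 11, .const 20 4, .op .add 20 8 20, .store 20 21]),
    .load 9 22]

/-- The room `5 * (T.size + 9)` includes one node beyond the present trie, the one that may be
created. The continuation is taken separately for an existing and a new child; the latter costs nine
more steps. -/
theorem wp_descend {S B N E L t P x i l τ : ℕ} {T : Trie} {m : ℕ → ℕ}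
    {Q : (ℕ → ℕ) → ℕ → Prop} (hm : Machine N E L t P T m) (hT : T.WF L)
    (hS : 5 * (T.size + 9) ≤ S) (hSB : S ≤ B) (h9 : m 9 = 5 * (i + 8)) (hi : i < T.size)
    (h2 : m 2 = x) (h11 : m 11 = 2 ^ (l + 1)) (hl : T.lev i = l + 1)
    (hpre : x / 2 ^ (l + 1) = T.pre i) (hLB : 2 ^ L ≤ B)
    (hold : T.child i (x / 2 ^ l % 2) ≠ 0 → ∀ m', Machine N E L t P T m' →
      m' 9 = 5 * (T.child i (x / 2 ^ l % 2) + 8) → m' 2 = x → m' 3 = m 3 → m' 11 = 2 ^ l →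
      Q m' (τ + 9))
    (hnew : T.child i (x / 2 ^ l % 2) = 0 → ∀ m', Machine N E L t P (T.alloc i (x / 2 ^ l % 2)) m' →
      m' 9 = 5 * (T.size + 8) → m' 2 = x → m' 3 = m 3 → m' 11 = 2 ^ l → Q m' (τ + 18)) :
    descend.wp S B Q m τ := by
  have e : 2 ^ (l + 1) / 2 = 2 ^ l := by rw [pow_succ, Nat.mul_div_cancel _ (by norm_num)]
  have hq2 : x / 2 ^ l / 2 = T.pre i := by rw [Nat.div_div_eq_div_mul, ← pow_succ, hpre]
  have hend : (x / 2 ^ l + 1) * 2 ^ l ≤ B := by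
    refine le_trans ?_ ((hT.hi_le i hi).trans hLB)
    rw [Trie.hi, hl, pow_succ]
    calc (x / 2 ^ l + 1) * 2 ^ l ≤ ((T.pre i + 1) * 2) * 2 ^ l :=
          Nat.mul_le_mul_right _ (by omega)
      _ = (T.pre i + 1) * (2 ^ l * 2) := by ring
  have hq1 : x / 2 ^ l + 1 ≤ B := le_trans (Nat.le_mul_of_pos_right _ (by positivity)) hend
  have hlB : 2 ^ l ≤ B :=
    le_trans (Nat.pow_le_pow_right (by norm_num) (by have := hT.lev_le i hi; omega)) hLB
  have hsize := hT.size_pos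
  have h8 := hm.cell8
  generalize hq : x / 2 ^ l = q at *
  have hb : q % 2 < 2 := Nat.mod_lt _ (by norm_num)
  have hc := hm.child i hi (q % 2) hb
  have hcs := hT.child_spec i hi (q % 2) hb
  generalize hbq : q % 2 = b at *
  have ha : 5 * (i + 8) + (b + 2) = 5 * (i + 8) + 2 + b := by omega
  have h8' : 5 * (T.size + 7) + 5 = 5 * (T.size + 8) := by omega
  by_cases hz : T.child i b = 0
  · rw [if_pos hz] at hc
    simp (disch := omega) only [descend, Cmd.wp_block_cons, Cmd.wp_block_nil, Cmd.wp, Op.eval,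
      Function.update_self, Function.update_of_ne, h9, h2, h11, e, hq, hbq, hc, ha, h8, h8']
    repeat refine ⟨by omega, ?_⟩
    intro _
    repeat refine ⟨by omega, ?_⟩
    refine hnew hz _ (hm.alloc hT hi hb ?_ ?_ ?_ ?_) ?_ ?_ ?_ ?_
    · simp (disch := omega) only [Function.update_self, Function.update_of_ne]
    · simp (disch := omega) only [Function.update_self, Function.update_of_ne]
    · simp (disch := omega) only [Function.update_self, Function.update_of_ne]
      rw [hl, Nat.add_sub_cancel, ← hq2, ← hbq]
      congr 1
      omega
    · intro a h1 h2 h3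
      simp (disch := omega) only [Function.update_of_ne]
    · simp only [Function.update_self]
    · simp (disch := omega) only [Function.update_of_ne, h2]
    · simp (disch := omega) only [Function.update_of_ne]
    · simp (disch := omega) only [Function.update_self, Function.update_of_ne]
  · rw [if_neg hz] at hc
    obtain ⟨hcs, -, -⟩ := hcs hz
    simp (disch := omega) only [descend, Cmd.wp_block_cons, Cmd.wp_block_nil, Cmd.wp, Op.eval,
      Function.update_self, Function.update_of_ne, h9, h2, h11, e, hq, hbq, hc, ha, h8]
    repeat refine ⟨by omega, ?_⟩
    refine ⟨fun _ => ?_, fun h => by omega⟩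
    repeat refine ⟨by omega, ?_⟩
    refine hold hz _ ?_ ?_ ?_ ?_ ?_
    · repeat refine Machine.scratch ?_ (by omega) _
      exact hm
    · simp only [Function.update_self]
    · simp (disch := omega) only [Function.update_of_ne, h2]
    · simp (disch := omega) only [Function.update_of_ne]
    · simp (disch := omega) only [Function.update_self, Function.update_of_ne]

/-- The trie summarizes the stream `σ` at time `t`, with total credit `H`. -/
structure Trie.Tracks (L K t : ℕ) (H : ℝ) (σ : List (ℕ × ℤˣ)) (T : Trie) : Prop where
  wf : T.WF L
  capped : T.Capped K t
  credit : T.Credit K t H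
  counts : T.Counts σ
  tot_le : ∀ i, T.tot i ≤ σ.length

theorem Trie.Tracks.root (L K t : ℕ) : (Trie.root L).Tracks L K t 0 [] :=
  ⟨.root L, .root K t L, .root K t L, .root L, fun i => by simp [Trie.tot, Trie.root]⟩

theorem Trie.Tracks.mono {L K t t' : ℕ} {H H' : ℝ} {σ : List (ℕ × ℤˣ)} {T : Trie}
    (h : T.Tracks L K t H σ) (ht : t ≤ t') (hH : H ≤ H') : T.Tracks L K t' H' σ :=
  ⟨h.wf, h.capped.mono ht, h.credit.mono ht hH, h.counts, h.tot_le⟩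

theorem Trie.Tracks.alloc {L K t : ℕ} {H : ℝ} {σ : List (ℕ × ℤˣ)} {T : Trie}
    (h : T.Tracks L K t H σ) (ht : 0 < t) {p b : ℕ} (hp : p < T.size) (hb : b < 2)
    (hl : T.lev p ≠ 0) (hc : T.child p b = 0) (hK : t < (T.tot p + 1) * K) :
    (T.alloc p b).Tracks L K t (H + 1 / t) σ :=
  ⟨h.wf.alloc hp hb hl hc, h.capped.alloc h.wf p b, h.credit.alloc h.wf ht hp hb hc hK,
    h.counts.alloc h.wf p b, h.tot_le⟩

theorem StreamAlg.encode_lt_two (y : ℤˣ) : encode y < 2 := by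
  unfold encode
  split_ifs <;> omega

theorem Trie.Tracks.incr {L K t : ℕ} {H : ℝ} {σ : List (ℕ × ℤˣ)} {T : Trie}
    (h : T.Tracks L K t H σ) (ht : 0 < t) {i : ℕ} (hi : i < T.size) (p : ℕ × ℤˣ)
    (hp : p.1 / 2 ^ T.lev i = T.pre i) (hK : T.lev i = 0 ∨ (T.tot i + 1) * K ≤ t) :
    (T.incr i (StreamAlg.encode p.2)).Tracks L K t (H + 1 / t) (σ ++ [p]) := by
  have hy := StreamAlg.encode_lt_two p.2
  refine ⟨h.wf.incr hi _, h.capped.incr hy hK, h.credit.incr ht hi hy, h.counts.incr hi p hp, ?_⟩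
  intro k
  have := h.tot_le k
  rw [Trie.tot_incr hy, List.length_append, List.length_singleton]
  split_ifs <;> omega

/-- One iteration of the search for the node at which an item is put. -/
def siftStep : Cmd := .block
  [.load 22 9, .const 20 1, .op .add 22 22 20, .op .mul 22 22 7, .op .lt 22 4 22,
    .ite 22 descend .skip]

/-- The state of the search after `k` iterations: cell `9` points to a node on the path of `x`. -/
def Sifting (N E L t P : ℕ) (H : ℝ) (σ : List (ℕ × ℤˣ)) (x y k : ℕ) (m : ℕ → ℕ) : Prop :=
  ∃ (T : Trie) (i : ℕ), Machine N E L t P T m ∧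
    T.Tracks L (L * 16 * E) t (H + k * (1 / t)) σ ∧ i < T.size ∧ m 9 = 5 * (i + 8) ∧ m 2 = x ∧
    m 3 = y ∧ m 11 = 2 ^ T.lev i ∧ x / 2 ^ T.lev i = T.pre i ∧
    (T.lev i + k = L ∨ L ≤ T.lev i + k ∧ (T.tot i + 1) * (L * 16 * E) ≤ t)

/-- The loop has no exit, so once a node with room is found the remaining iterations repeat the test
and leave the node unchanged. The clause `L ≤ lev + k` records that a node where the search stopped
is not below the depth reached by `k` steps; so for `k < L` the current node is above the leaves.
Each iteration is allowed one deposit `1 / t`. -/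
theorem wp_siftStep {S B N E L t P x y k τ : ℕ} {H : ℝ} {σ : List (ℕ × ℤˣ)} {m : ℕ → ℕ}
    (h : Sifting N E L t P H σ x y k m) (hk : k < L) (ht : 0 < t)
    (hroom : ∀ T : Trie, T.Credit (L * 16 * E) t (H + k * (1 / t)) → 5 * (T.size + 9) ≤ S)
    (hSB : S ≤ B) (hLB : 2 ^ L ≤ B) (hB : t + L * 16 * E ≤ B) (hσ : σ.length < B) :
    siftStep.wp S B (fun m' τ' => Sifting N E L t P H σ x y (k + 1) m' ∧ τ' ≤ τ + 24) m τ := by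
  obtain ⟨T, i, hm, hT, hi, h9, h2, h3, h11, hpre, hlev⟩ := h
  have hS := hroom T hT.credit
  have hsize := hT.wf.size_pos
  have htot := hm.tot i hi
  have h4 := hm.cell4
  have h7 := hm.cell7
  have htle := hT.tot_le i
  have hH : H + k * (1 / t) ≤ H + ((k + 1 : ℕ) : ℝ) * (1 / t) := by
    push_cast
    have : (0 : ℝ) ≤ 1 / t := by positivity
    linarith
  have hl0 : T.lev i ≠ 0 := by omega
  -- The cap bounds the product formed in the test by `t + K`, so it does not inflate the word
  -- length.
  have hprod : (T.tot i + 1) * (L * 16 * E) ≤ B := by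
    have := hT.capped i hi hl0
    rw [add_mul, one_mul]
    omega
  simp (disch := omega) only [siftStep, Cmd.wp_block_cons, Cmd.wp_block_nil, Cmd.wp, Op.eval,
    Function.update_self, Function.update_of_ne, h9, htot, h4, h7]
  by_cases hlt : t < (T.tot i + 1) * (L * 16 * E)
  · simp only [if_pos hlt]
    repeat refine ⟨by omega, ?_⟩
    refine ⟨fun _ => ?_, fun h => by omega⟩
    have hlk : T.lev i + k = L := hlev.resolve_right fun h => by omega
    obtain ⟨l, hl⟩ := Nat.exists_eq_succ_of_ne_zero hl0
    have hb : x / 2 ^ l % 2 < 2 := Nat.mod_lt _ (by norm_num)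
    have hq2 : x / 2 ^ l / 2 = T.pre i := by
      rw [Nat.div_div_eq_div_mul, ← pow_succ, ← Nat.succ_eq_add_one, ← hl, hpre]
    have hq : x / 2 ^ l = 2 * T.pre i + x / 2 ^ l % 2 := by
      rw [← hq2]; omega
    refine wp_descend (N := N) (E := E) (L := L) (t := t) (P := P) (x := x) (i := i) (l := l)
      (T := T) ?_ hT.wf hS hSB ?_ hi ?_ ?_ hl ?_ hLB ?_ ?_
    · repeat refine Machine.scratch ?_ (by omega) _
      exact hm
    · simp (disch := omega) only [Function.update_of_ne, h9]
    · simp (disch := omega) only [Function.update_of_ne, h2]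
    · simp (disch := omega) only [Function.update_of_ne, h11, hl]
    · rw [← Nat.succ_eq_add_one, ← hl, hpre]
    · intro hc m' hm' h9' h2' h3' h11'
      obtain ⟨c1, c2, c3⟩ := hT.wf.child_spec i hi _ hb hc
      have c4 : T.lev (T.child i (x / 2 ^ l % 2)) = l := by omega
      refine ⟨⟨T, _, hm', hT.mono le_rfl hH, c1, h9', h2', ?_, ?_, ?_, ?_⟩, by omega⟩
      · rw [h3']
        simp (disch := omega) only [Function.update_of_ne, h3]
      · rw [h11', c4]
      · rw [c3, c4, ← hq]
      · left; omega
    · intro hc m' hm' h9' h2' h3' h11'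
      have e1 : (T.alloc i (x / 2 ^ l % 2)).lev T.size = l := by
        simp [Trie.alloc, hl]
      have e2 : (T.alloc i (x / 2 ^ l % 2)).pre T.size = x / 2 ^ l := by
        simp only [Trie.alloc, Function.update_self]
        exact hq.symm
      refine ⟨⟨_, T.size, hm', (hT.alloc ht hi hb hl0 hc hlt).mono le_rfl ?_, Nat.lt_succ_self _,
        h9', h2', ?_, ?_, ?_, ?_⟩, by omega⟩
      · push_cast; linarith
      · rw [h3']
        simp (disch := omega) only [Function.update_of_ne, h3]
      · rw [h11', e1]
      · rw [e1, e2]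
      · left; rw [e1]; omega
  · simp only [if_neg hlt]
    repeat refine ⟨by omega, ?_⟩
    refine fun _ => ⟨⟨T, i, ?_, hT.mono le_rfl hH, hi, ?_, ?_, ?_, ?_, hpre, ?_⟩, by omega⟩
    · repeat refine Machine.scratch ?_ (by omega) _
      exact hm
    · simp (disch := omega) only [Function.update_of_ne, h9]
    · simp (disch := omega) only [Function.update_of_ne, h2]
    · simp (disch := omega) only [Function.update_of_ne, h3]
    · simp (disch := omega) only [Function.update_of_ne, h11]
    · right; omega

/-- Count the label in cell `3` at the node at the address in cell `9`. -/
def countItem : Cmd := .block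
  [.load 22 9, .const 20 1, .op .add 22 22 20, .store 9 22,
    .op .add 20 9 20, .load 22 20, .op .add 22 22 3, .store 20 22]

theorem wp_countItem {S B N E L t P i y τ : ℕ} {T : Trie} {m : ℕ → ℕ} {Q : (ℕ → ℕ) → ℕ → Prop}
    (hm : Machine N E L t P T m) (h9 : m 9 = 5 * (i + 8)) (hi : i < T.size)
    (h3 : m 3 = y) (hy : y < 2) (hS : 5 * (T.size + 9) ≤ S) (hSB : S ≤ B) (hB : T.tot i < B)
    (hQ : ∀ m', Machine N E L t P (T.incr i y) m' → Q m' (τ + 8)) :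
    countItem.wp S B Q m τ := by
  have htot := hm.tot i hi
  have hpos := hm.pos i hi
  have hcnt : T.cnt i 1 ≤ T.tot i := Nat.le_add_left _ _
  have hincr := fun m' => hm.incr hi hy (m' := m')
  have hae : 5 * (i + 8) + 1 < S := by omega
  generalize ha : 5 * (i + 8) = a at *
  have ha' : 40 ≤ a := by omega
  clear hm ha
  simp (disch := omega) only [countItem, Cmd.wp_block_cons, Cmd.wp_block_nil, Cmd.wp, Op.eval,
    Function.update_self, Function.update_of_ne, h9, htot, hpos, h3]
  repeat refine ⟨by omega, ?_⟩
  refine hQ _ (hincr _ ?_ ?_ ?_)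
  · simp (disch := omega) only [Function.update_self, Function.update_of_ne]
  · simp only [Function.update_self]
  · intro c h1 h2 h3
    simp (disch := omega) only [Function.update_of_ne]

/-- The program run on an arriving item. -/
def updateProg : Cmd := .block
  [.const 20 1, .op .add 4 4 20, .op .add 13 13 3, .const 9 40, .const 20 0, .op .add 11 6 20,
    .loop 5 siftStep, countItem]

theorem wp_updateProg {S B N E L t P τ : ℕ} {H : ℝ} {σ : List (ℕ × ℤˣ)} {m : ℕ → ℕ} {T : Trie}
    {p : ℕ × ℤˣ} (hm : Machine N E L t P T m) (hT : T.Tracks L (L * 16 * E) t H σ)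
    (h2 : m 2 = p.1) (h3 : m 3 = StreamAlg.encode p.2) (hp : p.1 < 2 ^ L)
    (hroom : ∀ T : Trie, T.Credit (L * 16 * E) (t + 1) (H + (L + 1) * (1 / (t + 1 : ℕ))) →
      5 * (T.size + 9) ≤ S)
    (hSB : S ≤ B) (hLB : 2 ^ L ≤ B) (hB : t + 1 + L * 16 * E ≤ B) (hσ : σ.length + 1 < B)
    (hP : P < B) :
    updateProg.wp S B (fun m' τ' => τ' ≤ τ + 16 + 25 * L ∧
      ∃ T', Machine N E L (t + 1) (P + StreamAlg.encode p.2) T' m' ∧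
        T'.Tracks L (L * 16 * E) (t + 1) (H + (L + 1) * (1 / (t + 1 : ℕ))) (σ ++ [p])) m τ := by
  have hinv : (0 : ℝ) ≤ 1 / (t + 1 : ℕ) := by positivity
  have hT1 : T.Tracks L (L * 16 * E) (t + 1) H σ := hT.mono (Nat.le_succ t) le_rfl
  have hS := hroom T (hT1.credit.mono le_rfl (by nlinarith [Nat.cast_nonneg (α := ℝ) L]))
  have hy := StreamAlg.encode_lt_two p.2
  have hsize := hT.wf.size_pos
  have c4 := hm.cell4
  have c5 := hm.cell5
  have c6 := hm.cell6
  have c13 := hm.cell13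
  simp (disch := omega) only [updateProg, Cmd.wp_block_cons, Cmd.wp_block_nil, Cmd.wp_const,
    Cmd.wp_op, Op.eval, Function.update_self, Function.update_of_ne, c4, c6, c13, h3]
  -- The side conditions of the six instructions before the loop. The number is explicit so that the
  -- loop's own precondition is not taken apart.
  iterate 18 refine ⟨by omega, ?_⟩
  refine Cmd.wp_loop (fun k m' τ' => Sifting N E L (t + 1) (P + StreamAlg.encode p.2) H σ p.1
    (StreamAlg.encode p.2) k m' ∧ τ' ≤ τ + 7 + 25 * k) (by omega) ?_ ?_ ?_
  · refine ⟨⟨T, 0, ?_, ?_, hsize, ?_, ?_, ?_, ?_, ?_, ?_⟩, by omega⟩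
    · have := (hm.scratch (d := 20) (by omega) 1).count (t' := t + 1)
        (P' := P + StreamAlg.encode p.2)
      repeat refine Machine.scratch ?_ (by omega) _
      exact this
    · simpa using hT1
    · simp (disch := omega) only [Function.update_self, Function.update_of_ne]
    · simp (disch := omega) only [Function.update_of_ne, h2]
    · simp (disch := omega) only [Function.update_of_ne, h3]
    · simp only [Function.update_self, hT.wf.lev_root, add_zero]
    · rw [hT.wf.lev_root, Nat.div_eq_of_lt hp]
      -- The root has prefix `0` because its interval, of length `2 ^ L`, ends at or before `2 ^ L`.
      have := hT.wf.hi_le 0 hsize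
      rw [Trie.hi, hT.wf.lev_root] at this
      by_contra hne
      have h1 : 2 ≤ T.pre 0 + 1 := by omega
      have h2 : 0 < 2 ^ L := by positivity
      nlinarith
    · left; rw [hT.wf.lev_root, add_zero]
  · simp (disch := omega) only [Function.update_of_ne, c5]
    rintro k hk m' τ' ⟨hs, hτ⟩
    refine Cmd.wp_mono _ _ _ ?_ _ _ (wp_siftStep hs hk (Nat.succ_pos t) ?_ hSB hLB hB (by omega))
    · rintro m'' τ'' ⟨g1, g2⟩
      exact ⟨g1, by omega⟩
    · intro T' hT'
      refine hroom T' (hT'.mono le_rfl ?_)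
      have : (k : ℝ) ≤ L + 1 := by exact_mod_cast (by omega : k ≤ L + 1)
      nlinarith
  · simp (disch := omega) only [Function.update_of_ne, c5]
    rintro m' τ' ⟨⟨T', i, hm', hT', hi, h9', h2', h3', h11', hpre, hlev⟩, hτ⟩
    have hS' := hroom T' (hT'.credit.mono le_rfl (by linarith))
    have htle := hT'.tot_le i
    refine wp_countItem hm' h9' hi h3' hy hS' hSB (by omega) fun m'' hm'' =>
      ⟨by omega, T'.incr i (StreamAlg.encode p.2), hm'', ?_⟩
    refine (hT'.incr (Nat.succ_pos t) hi p hpre ?_).mono le_rfl (by push_cast; linarith)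
    -- After `L` iterations a search that never stopped is at level `0`, where no cap applies.
    exact hlev.imp (fun h => by omega) (fun h => h.2)

/-! ### The setup program. -/

/-- Increment the level of the root, if it does not yet cover the universe. -/
def growStep : Cmd := .block
  [.op .lt 21 6 19, .op .add 5 5 21, .op .mul 21 21 6, .op .add 6 6 21]

/-- The program run before the stream. -/
def setupProg : Cmd := .block
  [.const 6 1, .const 20 1, .op .add 19 0 20, .loop 0 growStep,
    .const 21 16, .op .mul 7 5 21, .op .mul 7 7 1, .const 8 40, .const 21 44, .store 21 6]

/-- The comparison result `0` or `1` serves as the increment of `L` and, multiplied by `2 ^ L`, as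
the increment of the power. Doubling happens only while `2 ^ L ≤ N`, which preserves `2 ^ L ≤ 2 *
N`. -/
theorem wp_growStep {S B N L τ : ℕ} {m : ℕ → ℕ} {Q : (ℕ → ℕ) → ℕ → Prop}
    (h5 : m 5 = L) (h6 : m 6 = 2 ^ L) (h19 : m 19 = N + 1) (hS : 40 ≤ S) (hLB : L < B)
    (hB : 2 ^ L + N ≤ B) (hL : 2 ^ L ≤ 2 * N)
    (hQ : ∀ m' L', m' 5 = L' → m' 6 = 2 ^ L' → 2 ^ L' ≤ 2 * N →
      (2 ^ L ≤ N ∧ L' = L + 1 ∨ N < 2 ^ L ∧ L' = L) →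
      (∀ a, a < 5 ∨ 7 ≤ a ∧ a < 21 ∨ 40 ≤ a → m' a = m a) → Q m' (τ + 4)) :
    growStep.wp S B Q m τ := by
  have hpos : 0 < 2 ^ L := by positivity
  by_cases hlt : 2 ^ L < N + 1
  · simp (disch := omega) only [growStep, Cmd.wp_block_cons, Cmd.wp_block_nil, Cmd.wp, Op.eval,
      Function.update_self, Function.update_of_ne, h5, h6, h19, if_pos hlt, one_mul]
    repeat refine ⟨by omega, ?_⟩
    refine hQ _ (L + 1) ?_ ?_ ?_ (Or.inl ⟨by omega, rfl⟩) ?_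
    · simp (disch := omega) only [Function.update_self, Function.update_of_ne]
    · simp only [Function.update_self]
      rw [pow_succ]; omega
    · rw [pow_succ]; omega
    · intro a ha
      simp (disch := omega) only [Function.update_of_ne]
  · simp (disch := omega) only [growStep, Cmd.wp_block_cons, Cmd.wp_block_nil, Cmd.wp, Op.eval,
      Function.update_self, Function.update_of_ne, h5, h6, h19, if_neg hlt, zero_mul, add_zero]
    repeat refine ⟨by omega, ?_⟩
    refine hQ _ L ?_ ?_ hL (Or.inr ⟨by omega, rfl⟩) ?_
    · simp (disch := omega) only [Function.update_self, Function.update_of_ne]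
    · simp only [Function.update_self]
    · intro a ha
      simp (disch := omega) only [Function.update_of_ne]

theorem Machine.root {N E L : ℕ} {m : ℕ → ℕ} (h0 : m 0 = N) (h1 : m 1 = E) (h4 : m 4 = 0)
    (h5 : m 5 = L) (h6 : m 6 = 2 ^ L) (h7 : m 7 = L * 16 * E) (h8 : m 8 = 40) (h13 : m 13 = 0)
    (h44 : m 44 = 2 ^ L) (hz : ∀ a, 40 ≤ a → a ≠ 44 → m a = 0) :
    Machine N E L 0 0 (Trie.root L) m := by
  have hi0 : ∀ i < (Trie.root L).size, i = 0 := fun i hi => Nat.lt_one_iff.mp hi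
  refine ⟨h0, h1, h4, h5, h6, h7, h8, h13, ?_, ?_, ?_, ?_, ?_⟩
  · intro i hi
    rw [hi0 i hi]
    exact hz _ (by omega) (by omega)
  · intro i hi
    rw [hi0 i hi]
    exact hz _ (by omega) (by omega)
  · intro i hi b hb
    rw [hi0 i hi]
    exact hz _ (by omega) (by omega)
  · intro i hi
    rw [hi0 i hi]
    simpa [Trie.hi, Trie.root] using h44
  · intro a ha
    have : 45 ≤ a := ha
    exact hz a (by omega) (by omega)

theorem wp_setupProg {S B N E τ : ℕ} {m : ℕ → ℕ} {Q : (ℕ → ℕ) → ℕ → Prop}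
    (h0 : m 0 = N) (h1 : m 1 = E) (hz : ∀ a, 2 ≤ a → m a = 0) (hN : 1 ≤ N) (hE : 1 ≤ E)
    (hS : 45 ≤ S) (hSB : S ≤ B) (hB : 2 * N * 16 * E ≤ B)
    (hQ : ∀ m' L τ', 1 ≤ L → 2 ^ L ≤ 2 * N → N < 2 ^ L → Machine N E L 0 0 (Trie.root L) m' →
      Q m' τ') :
    setupProg.wp S B Q m τ := by
  have hNB : 2 * N * 16 ≤ B := (Nat.le_mul_of_pos_right _ hE).trans hB
  have z4 := hz 4 (by omega)
  have z5 := hz 5 (by omega)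
  have z13 := hz 13 (by omega)
  simp (disch := omega) only [setupProg, Cmd.wp_block_cons, Cmd.wp_block_nil, Cmd.wp_const,
    Cmd.wp_op, Op.eval, Function.update_self, Function.update_of_ne, h0]
  iterate 8 refine ⟨by omega, ?_⟩
  refine Cmd.wp_loop (fun k m' _ => ∃ L, m' 5 = L ∧ m' 6 = 2 ^ L ∧ 2 ^ L ≤ 2 * N ∧
    (L = k ∨ L ≤ k ∧ N < 2 ^ L) ∧ m' 0 = N ∧ m' 1 = E ∧ m' 4 = 0 ∧ m' 13 = 0 ∧ m' 19 = N + 1 ∧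
    ∀ a, 40 ≤ a → m' a = 0) (by omega) ?_ ?_ ?_
  · refine ⟨0, ?_, ?_, by omega, Or.inl rfl, ?_, ?_, ?_, ?_, ?_, ?_⟩
    · simp (disch := omega) only [Function.update_of_ne, z5]
    · simp (disch := omega) only [Function.update_self, Function.update_of_ne, pow_zero]
    · simp (disch := omega) only [Function.update_of_ne, h0]
    · simp (disch := omega) only [Function.update_of_ne, h1]
    · simp (disch := omega) only [Function.update_of_ne, z4]
    · simp (disch := omega) only [Function.update_of_ne, z13]
    · simp only [Function.update_self]
    · intro a ha
      have := hz a (by omega)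
      simp (disch := omega) only [Function.update_of_ne, this]
  · rintro k - m' τ' ⟨L, g5, g6, gL, gk, g0, g1, g4, g13, g19, gz⟩
    have : L < 2 ^ L := Nat.lt_two_pow_self
    refine wp_growStep g5 g6 g19 (by omega) (by omega) (by omega) gL ?_
    intro m'' L' e5 e6 eL ek ef
    refine ⟨L', e5, e6, eL, ?_, ?_, ?_, ?_, ?_, ?_, ?_⟩
    · rcases ek with ⟨e1, e2⟩ | ⟨e1, e2⟩
      · left
        rcases gk with g | g <;> omega
      · right
        subst e2
        exact ⟨by omega, e1⟩
    · rw [ef _ (by omega), g0]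
    · rw [ef _ (by omega), g1]
    · rw [ef _ (by omega), g4]
    · rw [ef _ (by omega), g13]
    · rw [ef _ (by omega), g19]
    · intro a ha
      rw [ef _ (by omega), gz a ha]
  · simp (disch := omega) only [Function.update_of_ne, h0]
    rintro m' τ' ⟨L, g5, g6, gL, gk, g0, g1, g4, g13, g19, gz⟩
    -- The `N` passes suffice: if the level was raised in each of them, then `L = N < 2 ^ L`.
    have hL : L < 2 ^ L := Nat.lt_two_pow_self
    have hNL : N < 2 ^ L := by
      rcases gk with rfl | g
      · exact hL
      · exact g.2
    have hL1 : 1 ≤ L := by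
      by_contra h
      obtain rfl : L = 0 := by omega
      omega
    have hLE1 : L * 16 ≤ B := by omega
    have hLE : L * 16 * E ≤ B := by
      refine le_trans ?_ hB
      exact Nat.mul_le_mul_right _ (by omega)
    clear gk
    simp (disch := omega) only [Cmd.wp, Op.eval, Function.update_self, Function.update_of_ne, g5,
      g6, g1]
    repeat refine ⟨by omega, ?_⟩
    refine hQ _ L _ hL1 gL hNL (Machine.root ?_ ?_ ?_ ?_ ?_ ?_ ?_ ?_ ?_ ?_)
    · simp (disch := omega) only [Function.update_of_ne, g0]
    · simp (disch := omega) only [Function.update_of_ne, g1]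
    · simp (disch := omega) only [Function.update_of_ne, g4]
    · simp (disch := omega) only [Function.update_of_ne, g5]
    · simp (disch := omega) only [Function.update_of_ne, g6]
    · simp (disch := omega) only [Function.update_self, Function.update_of_ne]
    · simp (disch := omega) only [Function.update_self, Function.update_of_ne]
    · simp (disch := omega) only [Function.update_of_ne, g13]
    · simp only [Function.update_self]
    · intro a h1 h2
      have := gz a h1
      simp (disch := omega) only [Function.update_of_ne, this]

/-! ### The final program: the score of every split and its minimum. -/

/-- Add the counters of the node at the address in cell `26` to the sums for the split `j`, where
cell `27` holds `j + 1`, if its interval ends there or before, and move to the next node. -/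
def sumStep : Cmd := .block
  [.const 20 4, .op .add 21 26 20, .load 22 21, .op .lt 22 27 22,
    .ite 22 .skip (.block [.load 22 26, .op .add 24 24 22, .const 20 1, .op .add 21 26 20,
      .load 22 21, .op .add 25 25 22]),
    .const 20 5, .op .add 26 26 20]

theorem wp_sumStep {S B j k u v : ℕ} {τ : ℕ} {m : ℕ → ℕ} {Q : (ℕ → ℕ) → ℕ → Prop} {w r h : ℕ}
    (h26 : m 26 = 5 * (k + 8)) (h27 : m 27 = j + 1) (h24 : m 24 = u) (h25 : m 25 = v)
    (hw : m (5 * (k + 8)) = w) (hr : m (5 * (k + 8) + 1) = r) (hh : m (5 * (k + 8) + 4) = h)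
    (hS : 5 * (k + 9) ≤ S) (hSB : S ≤ B) (hhB : h ≤ B) (hwB : w ≤ B) (hrB : r ≤ B)
    (huB : u + (if h ≤ j + 1 then w else 0) ≤ B) (hvB : v + (if h ≤ j + 1 then r else 0) ≤ B)
    (hQ : ∀ m' τ', m' 26 = 5 * (k + 1 + 8) → m' 24 = u + (if h ≤ j + 1 then w else 0) →
      m' 25 = v + (if h ≤ j + 1 then r else 0) →
      (∀ a, a < 20 ∨ a = 27 ∨ 40 ≤ a → m' a = m a) → Q m' τ') :
    sumStep.wp S B Q m τ := by
  have e : 5 * (k + 8) + 5 = 5 * (k + 1 + 8) := by omega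
  have e' : 5 * (k + 1 + 8) ≤ B := by omega
  have ha' : 40 ≤ 5 * (k + 8) := by omega
  generalize 5 * (k + 1 + 8) = a' at *
  have haS : 5 * (k + 8) + 4 < S := by omega
  generalize 5 * (k + 8) = a at *
  by_cases hlt : j + 1 < h
  · rw [if_neg (by omega)] at huB hvB hQ
    rw [if_neg (by omega), add_zero, add_zero] at hQ
    simp (disch := omega) only [sumStep, Cmd.wp_block_cons, Cmd.wp_block_nil, Cmd.wp, Op.eval,
      Function.update_self, Function.update_of_ne, h26, h27, hh, if_pos hlt, e]
    repeat refine ⟨by omega, ?_⟩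
    refine ⟨fun _ => ?_, fun h => by omega⟩
    repeat refine ⟨by omega, ?_⟩
    refine hQ _ _ ?_ ?_ ?_ ?_
    · simp only [Function.update_self]
    · simp (disch := omega) only [Function.update_of_ne, h24]
    · simp (disch := omega) only [Function.update_of_ne, h25]
    · intro c hc
      simp (disch := omega) only [Function.update_of_ne]
  · rw [if_pos (by omega)] at huB hvB hQ
    rw [if_pos (by omega)] at hQ
    simp (disch := omega) only [sumStep, Cmd.wp_block_cons, Cmd.wp_block_nil, Cmd.wp, Op.eval,
      Function.update_self, Function.update_of_ne, h26, h27, hh, hw, hr, h24, h25, if_neg hlt, e]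
    repeat refine ⟨by omega, ?_⟩
    intro _
    repeat refine ⟨by omega, ?_⟩
    refine hQ _ _ ?_ ?_ ?_ ?_
    · simp only [Function.update_self]
    · simp (disch := omega) only [Function.update_self, Function.update_of_ne]
    · simp (disch := omega) only [Function.update_self, Function.update_of_ne]
    · intro c hc
      simp (disch := omega) only [Function.update_of_ne]

/-- The loss of a split with `a` of `t` items on the left, where `p` of the `a` and `P` of the `t`
items have label `1`, in units of `2 / (t * M)` and rounded. -/
def splitScore (M t P a p : ℕ) : ℕ :=
  (a - p) * p * M / a + (t - a - (P - p)) * (P - p) * M / (t - a)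

/-- Evaluate a split from its sums in cells `24` and `25`, and keep it if it is the best so far. -/
def evalSplit : Cmd := .block
  [.op .sub 28 24 25, .op .mul 28 28 25, .op .mul 28 28 15, .op .div 28 28 24,
    .op .sub 24 4 24, .op .sub 25 13 25, .op .sub 29 24 25, .op .mul 29 29 25, .op .mul 29 29 15,
    .op .div 29 29 24, .op .add 28 28 29, .op .lt 29 28 16,
    .ite 29 (.block [.const 20 0, .op .add 16 28 20, .op .add 17 18 20]) .skip,
    .const 20 1, .op .add 18 18 20]

theorem splitScore_le {M t P a p : ℕ} (ha : a ≤ t) (hp : p ≤ t) (hP : P ≤ t) :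
    splitScore M t P a p ≤ 2 * (t * t * M) := by
  have h1 : (a - p) * p * M ≤ t * t * M := by gcongr; omega
  have h2 : (t - a - (P - p)) * (P - p) * M ≤ t * t * M := by gcongr <;> omega
  have := (Nat.div_le_self ((a - p) * p * M) a).trans h1
  have := (Nat.div_le_self ((t - a - (P - p)) * (P - p) * M) (t - a)).trans h2
  rw [splitScore]
  omega

theorem wp_evalSplit {S B M t P a p s b j : ℕ} {τ : ℕ} {m : ℕ → ℕ} {Q : (ℕ → ℕ) → ℕ → Prop}
    (h4 : m 4 = t) (h13 : m 13 = P) (h15 : m 15 = M) (h16 : m 16 = s) (h17 : m 17 = b)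
    (h18 : m 18 = j) (h24 : m 24 = a) (h25 : m 25 = p) (ha : a ≤ t) (hp : p ≤ t) (hP : P ≤ t)
    (hS : 40 ≤ S) (hSB : S ≤ B) (hB : 2 * (t * t * M) ≤ B) (hM : 1 ≤ M) (hj : j < B)
    (hQ : ∀ m' τ', m' 18 = j + 1 →
      (splitScore M t P a p < s ∧ m' 16 = splitScore M t P a p ∧ m' 17 = j ∨
        s ≤ splitScore M t P a p ∧ m' 16 = s ∧ m' 17 = b) →
      (∀ a, a < 16 ∨ a = 19 ∨ 40 ≤ a → m' a = m a) → Q m' τ') :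
    evalSplit.wp S B Q m τ := by
  have hle := splitScore_le (M := M) (P := P) ha hp hP
  have htt : t * t ≤ t * t * M := Nat.le_mul_of_pos_right _ hM
  have ht : t ≤ t * t := Nat.le_mul_self t
  have e1 : (a - p) * p ≤ t * t := by gcongr; omega
  have e2 : (t - a - (P - p)) * (P - p) ≤ t * t := by gcongr <;> omega
  have e3 : (a - p) * p * M ≤ t * t * M := by gcongr
  have e4 : (t - a - (P - p)) * (P - p) * M ≤ t * t * M := by gcongr
  have e5 := Nat.div_le_self ((a - p) * p * M) a
  have e6 := Nat.div_le_self ((t - a - (P - p)) * (P - p) * M) (t - a)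
  have b1 : a - p ≤ B := by omega
  have b2 : (a - p) * p ≤ B := by omega
  have b3 : (a - p) * p * M ≤ B := by omega
  have b4 : (a - p) * p * M / a ≤ B := by omega
  have b5 : t - a ≤ B := by omega
  have b6 : P - p ≤ B := by omega
  have b7 : t - a - (P - p) ≤ B := by omega
  have b8 : (t - a - (P - p)) * (P - p) ≤ B := by omega
  have b9 : (t - a - (P - p)) * (P - p) * M ≤ B := by omega
  have b10 : (t - a - (P - p)) * (P - p) * M / (t - a) ≤ B := by omega
  have b11 : splitScore M t P a p ≤ B := by omega
  have hs : (a - p) * p * M / a + (t - a - (P - p)) * (P - p) * M / (t - a) =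
    splitScore M t P a p := rfl
  have B40 : 40 ≤ B := by omega
  clear e1 e2 e3 e4 e5 e6 htt ht hle hB hp ha hP
  generalize splitScore M t P a p = z at *
  by_cases hlt : z < s
  · simp (disch := decide) only [evalSplit, Cmd.wp_block_cons, Cmd.wp_block_nil, Cmd.wp, Op.eval,
      Function.update_self, Function.update_of_ne, h4, h13, h15, h16, h18, h24, h25, hs,
      if_pos hlt, add_zero, b1, b2, b3, b4, b5, b6, b7, b8, b9, b10, b11, true_and]
    clear b1 b2 b3 b4 b5 b6 b7 b8 b9 b10 hs
    repeat refine ⟨by omega, ?_⟩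
    refine ⟨fun _ => ?_, fun h => by omega⟩
    repeat refine ⟨by omega, ?_⟩
    refine hQ _ _ ?_ (Or.inl ⟨hlt, ?_, ?_⟩) ?_
    · simp only [Function.update_self]
    · simp (disch := decide) only [Function.update_self, Function.update_of_ne]
    · simp (disch := decide) only [Function.update_self, Function.update_of_ne]
    · intro c hc
      simp (disch := omega) only [Function.update_of_ne]
  · simp (disch := decide) only [evalSplit, Cmd.wp_block_cons, Cmd.wp_block_nil, Cmd.wp, Op.eval,
      Function.update_self, Function.update_of_ne, h4, h13, h15, h16, h18, h24, h25, hs,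
      if_neg hlt, b1, b2, b3, b4, b5, b6, b7, b8, b9, b10, b11, true_and]
    clear b1 b2 b3 b4 b5 b6 b7 b8 b9 b10 hs
    repeat refine ⟨by omega, ?_⟩
    intro _
    repeat refine ⟨by omega, ?_⟩
    refine hQ _ _ ?_ (Or.inr ⟨by omega, ?_, ?_⟩) ?_
    · simp only [Function.update_self]
    · simp (disch := decide) only [Function.update_of_ne, h16]
    · simp (disch := decide) only [Function.update_of_ne, h17]
    · intro c hc
      simp (disch := omega) only [Function.update_of_ne]

/-- Compute the score of the split in cell `18`, and keep the split if it is the best so far. -/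
def scoreStep : Cmd := .block
  [.const 24 0, .const 25 0, .const 26 40, .const 20 1, .op .add 27 18 20, .loop 14 sumStep,
    evalSplit]

/-- The program run after the stream. -/
def finishProg : Cmd := .block
  [.const 20 5, .op .div 14 8 20, .const 20 7, .op .sub 14 14 20, .const 20 16, .op .mul 15 1 20,
    .op .mul 16 4 4, .op .mul 16 16 15, .op .add 16 16 16, .const 17 0, .const 18 0,
    .const 20 1, .op .add 19 0 20, .loop 19 scoreStep, .const 20 0, .op .add 0 17 20]

/-- The score of the split `j` according to the trie. -/
def Trie.score (T : Trie) (E t P j : ℕ) : ℕ :=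
  splitScore (E * 16) t P (T.below j 0 + T.below j 1) (T.below j 1)

theorem Trie.below_eq (T : Trie) (j : ℕ) : T.below j 0 + T.below j 1 =
    ∑ i ∈ Finset.range T.size, if T.hi i ≤ j + 1 then T.tot i else 0 := by
  rw [below, below, ← Finset.sum_add_distrib]
  refine Finset.sum_congr rfl fun i _ => ?_
  split_ifs <;> rfl

theorem leftCount_add_le (σ : List (ℕ × ℤˣ)) (j : ℕ) :
    leftCount σ j 0 + leftCount σ j 1 ≤ σ.length := by
  induction σ with
  | nil => simp [leftCount]
  | cons p σ ih =>
    simp only [leftCount, List.countP_cons, List.length_cons, decide_eq_true_eq] at ih ⊢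
    split_ifs <;> omega

theorem sum_range_le_sum_range {f : ℕ → ℕ} {k n : ℕ} (h : k ≤ n) :
    ∑ i ∈ Finset.range k, f i ≤ ∑ i ∈ Finset.range n, f i :=
  Finset.sum_le_sum_of_subset (Finset.range_subset_range.mpr h)

/-- The accumulated counts stay at most `t`, because partial sums are bounded by the full sums
`below`, which undercount the left part of the split. -/
theorem wp_scoreStep {S B N E L t P K s b j τ : ℕ} {H : ℝ} {σ : List (ℕ × ℤˣ)} {T : Trie}
    {m : ℕ → ℕ} {Q : (ℕ → ℕ) → ℕ → Prop} (hm : Machine N E L t P T m) (hT : T.Tracks L K t H σ)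
    (hσ : σ.length = t) (hP : P ≤ t) (hE : 1 ≤ E) (h14 : m 14 = T.size) (h15 : m 15 = E * 16)
    (h16 : m 16 = s) (h17 : m 17 = b) (h18 : m 18 = j)
    (hS : 5 * (T.size + 9) ≤ S) (hSB : S ≤ B) (hLB : 2 ^ L ≤ B)
    (hB : 2 * (t * t * (E * 16)) ≤ B) (hj : j < B)
    (hQ : ∀ m' τ', m' 18 = j + 1 →
      (T.score E t P j < s ∧ m' 16 = T.score E t P j ∧ m' 17 = j ∨
        s ≤ T.score E t P j ∧ m' 16 = s ∧ m' 17 = b) →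
      (∀ a, a < 16 ∨ a = 19 ∨ 40 ≤ a → m' a = m a) → Q m' τ') :
    scoreStep.wp S B Q m τ := by
  have hsize := hT.wf.size_pos
  have htB : t ≤ B := by
    have h1 : t ≤ t * t := Nat.le_mul_self t
    have h2 : t * t ≤ t * t * (E * 16) := Nat.le_mul_of_pos_right _ (by omega)
    omega
  have hfull : T.below j 0 + T.below j 1 ≤ t := by
    rw [← hσ]
    exact le_trans (add_le_add (hT.counts j 0).1 (hT.counts j 1).1) (leftCount_add_le σ j)
  have hsum := T.below_eq j
  simp (disch := omega) only [scoreStep, Cmd.wp_block_cons, Cmd.wp_block_nil, Cmd.wp_const,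
    Cmd.wp_op, Op.eval, Function.update_self, Function.update_of_ne, h18]
  iterate 12 refine ⟨by omega, ?_⟩
  refine Cmd.wp_loop (fun k m' _ => m' 26 = 5 * (k + 8) ∧ m' 27 = j + 1 ∧
    m' 24 = (∑ i ∈ Finset.range k, if T.hi i ≤ j + 1 then T.tot i else 0) ∧
    m' 25 = (∑ i ∈ Finset.range k, if T.hi i ≤ j + 1 then T.cnt i 1 else 0) ∧
    ∀ a, a < 20 ∨ 40 ≤ a → m' a = m a) (by omega) ?_ ?_ ?_
  · refine ⟨?_, ?_, ?_, ?_, ?_⟩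
    · simp (disch := omega) only [Function.update_self, Function.update_of_ne]
    · simp only [Function.update_self]
    · simp (disch := omega) only [Function.update_self, Function.update_of_ne,
        Finset.range_zero, Finset.sum_empty]
    · simp (disch := omega) only [Function.update_self, Function.update_of_ne,
        Finset.range_zero, Finset.sum_empty]
    · intro a ha
      simp (disch := omega) only [Function.update_of_ne]
  · simp (disch := omega) only [Function.update_of_ne, h14]
    rintro k hk m' τ' ⟨g26, g27, g24, g25, gf⟩
    have htot := hT.tot_le k
    have hcnt : T.cnt k 1 ≤ T.tot k := Nat.le_add_left _ _
    refine wp_sumStep g26 g27 g24 g25 ((gf _ (by omega)).trans (hm.tot k hk))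
      ((gf _ (by omega)).trans (hm.pos k hk)) ((gf _ (by omega)).trans (hm.hi k hk))
      (by omega) hSB ((hT.wf.hi_le k hk).trans hLB) (by omega) (by omega) ?_ ?_ ?_
    · rw [← Finset.sum_range_succ (fun i => if T.hi i ≤ j + 1 then T.tot i else 0)]
      have := sum_range_le_sum_range (f := fun i => if T.hi i ≤ j + 1 then T.tot i else 0)
        (Nat.succ_le_of_lt hk)
      simp only [Nat.succ_eq_add_one] at this
      omega
    · rw [← Finset.sum_range_succ (fun i => if T.hi i ≤ j + 1 then T.cnt i 1 else 0)]
      have := sum_range_le_sum_range (f := fun i => if T.hi i ≤ j + 1 then T.cnt i 1 else 0)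
        (Nat.succ_le_of_lt hk)
      simp only [Nat.succ_eq_add_one] at this
      have e : ∑ i ∈ Finset.range T.size, (if T.hi i ≤ j + 1 then T.cnt i 1 else 0) =
        T.below j 1 := rfl
      omega
    · intro m'' τ'' e26 e24 e25 ef
      refine ⟨e26, ?_, ?_, ?_, ?_⟩
      · rw [ef _ (by omega), g27]
      · rw [e24, Finset.sum_range_succ]
      · rw [e25, Finset.sum_range_succ]
      · intro a ha
        rw [ef a (by omega), gf a ha]
  · simp (disch := omega) only [Function.update_of_ne, h14]
    rintro m' τ' ⟨g26, g27, g24, g25, gf⟩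
    rw [← hsum] at g24
    change m' 25 = T.below j 1 at g25
    refine wp_evalSplit (t := t) (P := P) (M := E * 16) (s := s) (b := b) (j := j)
      ((gf _ (by omega)).trans hm.cell4) ((gf _ (by omega)).trans hm.cell13)
      ((gf _ (by omega)).trans h15) ((gf _ (by omega)).trans h16) ((gf _ (by omega)).trans h17)
      ((gf _ (by omega)).trans h18) g24 g25 hfull (by omega) hP (by omega) hSB hB (by omega) hj ?_
    intro m'' τ'' e18 es ef
    refine hQ m'' τ'' e18 es ?_
    intro a ha
    rw [ef a ha, gf a (by omega)]

theorem Machine.congr {N E L t P : ℕ} {T : Trie} {m m' : ℕ → ℕ} (h : Machine N E L t P T m)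
    (hm : ∀ a, a < 14 ∨ 40 ≤ a → m' a = m a) : Machine N E L t P T m' := by
  constructor
  · rw [hm _ (by omega), h.cell0]
  · rw [hm _ (by omega), h.cell1]
  · rw [hm _ (by omega), h.cell4]
  · rw [hm _ (by omega), h.cell5]
  · rw [hm _ (by omega), h.cell6]
  · rw [hm _ (by omega), h.cell7]
  · rw [hm _ (by omega), h.cell8]
  · rw [hm _ (by omega), h.cell13]
  · intro i hi; rw [hm _ (by omega), h.tot i hi]
  · intro i hi; rw [hm _ (by omega), h.pos i hi]
  · intro i hi b hb; rw [hm _ (by omega), h.child i hi b hb]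
  · intro i hi; rw [hm _ (by omega), h.hi i hi]
  · intro a ha; rw [hm _ (by omega), h.fresh a ha]

theorem wp_finishProg {S B N E L t P K τ : ℕ} {H : ℝ} {σ : List (ℕ × ℤˣ)} {T : Trie}
    {m : ℕ → ℕ} (hm : Machine N E L t P T m) (hT : T.Tracks L K t H σ)
    (hσ : σ.length = t) (hP : P ≤ t) (hE : 1 ≤ E)
    (hS : 5 * (T.size + 9) ≤ S) (hSB : S ≤ B) (hLB : 2 ^ L ≤ B)
    (hB : 2 * (t * t * (E * 16)) ≤ B) (hEB : E * 16 ≤ B) (hN : N < B) :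
    finishProg.wp S B (fun m' _ => m' 0 ≤ N ∧
      ∀ j ≤ N, T.score E t P (m' 0) ≤ T.score E t P j) m τ := by
  have hsize := hT.wf.size_pos
  have htt : t * t ≤ t * t * (E * 16) := Nat.le_mul_of_pos_right _ (by omega)
  have hle : ∀ j, T.score E t P j ≤ 2 * (t * t * (E * 16)) := by
    intro j
    have hfull : T.below j 0 + T.below j 1 ≤ t := by
      rw [← hσ]
      exact le_trans (add_le_add (hT.counts j 0).1 (hT.counts j 1).1) (leftCount_add_le σ j)
    exact splitScore_le hfull (by omega) hP
  have h8 := hm.cell8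
  have h0 := hm.cell0
  have h1 := hm.cell1
  have h4 := hm.cell4
  have e1 : 5 * (T.size + 7) / 5 = T.size + 7 := Nat.mul_div_cancel_left _ (by norm_num)
  have b1 : T.size + 7 ≤ B := by omega
  have b2 : t * t ≤ B := by omega
  have b3 : t * t * (E * 16) + t * t * (E * 16) ≤ B := by omega
  have b4 : t * t * (E * 16) ≤ B := by omega
  have e2 : t * t * (E * 16) + t * t * (E * 16) = 2 * (t * t * (E * 16)) := by omega
  have b5 : T.size ≤ B := by omega
  have B40 : 45 ≤ B := by omega
  have S40 : 45 ≤ S := by omega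
  simp (disch := decide) only [finishProg, Cmd.wp_block_cons, Cmd.wp_block_nil, Cmd.wp_const,
    Cmd.wp_op, Op.eval, Function.update_self, Function.update_of_ne, h8, h0, h1, h4, e1,
    Nat.add_sub_cancel, b1, b2, b3, b4, b5, hEB, true_and]
  iterate 34 refine ⟨by omega, ?_⟩
  clear b1 b2 b3 b4 b5 e1 htt
  -- Cell `16` starts as an upper bound for all scores, with split `0` in cell `17`. Hence the
  -- invariant only asks that the score of the kept split be at most cell `16`, while cell `16` is
  -- at most every score examined.
  refine Cmd.wp_loop (fun k m' _ => m' 18 = k ∧ m' 17 ≤ N ∧ T.score E t P (m' 17) ≤ m' 16 ∧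
    m' 16 ≤ B ∧ (∀ j < k, m' 16 ≤ T.score E t P j) ∧ m' 14 = T.size ∧ m' 15 = E * 16 ∧
    ∀ a, a < 14 ∨ 40 ≤ a → m' a = m a) (by omega) ?_ ?_ ?_
  · refine ⟨?_, ?_, ?_, ?_, fun j hj => absurd hj (Nat.not_lt_zero _), ?_, ?_, ?_⟩
    · simp (disch := decide) only [Function.update_self, Function.update_of_ne]
    · simp (disch := decide) only [Function.update_self, Function.update_of_ne]
      exact Nat.zero_le _
    · simp (disch := decide) only [Function.update_self, Function.update_of_ne, e2]
      exact hle 0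
    · simp (disch := decide) only [Function.update_self, Function.update_of_ne, e2]
      exact hB
    · simp (disch := decide) only [Function.update_self, Function.update_of_ne]
    · simp (disch := decide) only [Function.update_self, Function.update_of_ne]
    · intro a ha
      simp (disch := omega) only [Function.update_of_ne]
  · simp only [Function.update_self]
    rintro k hk m' τ' ⟨g18, g17, gle, gB, gmin, g14, g15, gf⟩
    have hfr : ∀ m'' : ℕ → ℕ, m'' 14 = m' 14 → m'' 15 = m' 15 →
        (∀ a, a < 14 ∨ 40 ≤ a → m'' a = m' a) → m'' 14 = T.size ∧ m'' 15 = E * 16 ∧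
          ∀ a, a < 14 ∨ 40 ≤ a → m'' a = m a := fun m'' f1 f2 f3 =>
      ⟨f1.trans g14, f2.trans g15, fun a ha => (f3 a ha).trans (gf a ha)⟩
    refine wp_scoreStep (hm.congr gf) hT hσ hP hE g14 g15 rfl rfl g18 hS hSB hLB hB (by omega) ?_
    rintro m'' τ'' e18 (⟨e1, e16, e17⟩ | ⟨e1, e16, e17⟩) ef
    · refine ⟨e18, by omega, by rw [e16, e17], (e16.trans_le (hle k)).trans hB, ?_,
        hfr m'' (ef _ (by omega)) (ef _ (by omega)) fun a ha => ef a (by omega)⟩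
      intro j hj
      rcases Nat.lt_succ_iff_lt_or_eq.mp hj with hj | rfl
      · have := gmin j hj
        omega
      · exact e16.le
    · refine ⟨e18, by omega, by rw [e16, e17]; exact gle, by omega, ?_,
        hfr m'' (ef _ (by omega)) (ef _ (by omega)) fun a ha => ef a (by omega)⟩
      intro j hj
      rcases Nat.lt_succ_iff_lt_or_eq.mp hj with hj | rfl
      · have := gmin j hj
        omega
      · omega
  · simp only [Function.update_self]
    rintro m' τ' ⟨g18, g17, gle, gB, gmin, g14, g15, gf⟩
    simp (disch := decide) only [Cmd.wp, Op.eval, Function.update_self, Function.update_of_ne,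
      add_zero]
    repeat refine ⟨by omega, ?_⟩
    exact fun j hj => gle.trans (gmin j (by omega))

/-! ### Gini impurity and its stability under misplaced items. -/

/-- Half the size of a multiset with `p` elements of one label and `q` of the other, times its Gini
impurity. -/
def impurity (p q : ℝ) : ℝ := p * q / (p + q)

theorem impurity_comm (p q : ℝ) : impurity p q = impurity q p := by
  rw [impurity, impurity, mul_comm, add_comm]

/-- The increment equals `q ^ 2 * d / ((p + q) * (p + d + q))`, which lies between `0` and `d`. If
`p + q = 0`, division by zero gives impurity `0` on both sides. -/
theorem impurity_add_left {p q d : ℝ} (hp : 0 ≤ p) (hq : 0 ≤ q) (hd : 0 ≤ d) :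
    impurity p q ≤ impurity (p + d) q ∧ impurity (p + d) q ≤ impurity p q + d := by
  rcases (add_nonneg hp hq).eq_or_lt' with h | h
  · obtain rfl : p = 0 := by linarith
    obtain rfl : q = 0 := by linarith
    simp [impurity, hd]
  · have h' : 0 < p + d + q := by linarith
    have e : impurity (p + d) q - impurity p q = q ^ 2 * d / ((p + q) * (p + d + q)) := by
      rw [impurity, impurity]
      field_simp
      ring
    have h1 : 0 ≤ q ^ 2 * d / ((p + q) * (p + d + q)) := by positivity
    have h2 : q ^ 2 * d / ((p + q) * (p + d + q)) ≤ d := by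
      rw [div_le_iff₀ (by positivity), mul_comm]
      refine mul_le_mul_of_nonneg_left ?_ hd
      nlinarith [mul_nonneg hp hq, mul_nonneg hp hd, mul_nonneg hd hq]
    constructor <;> linarith

theorem impurity_add {p q d e : ℝ} (hp : 0 ≤ p) (hq : 0 ≤ q) (hd : 0 ≤ d) (he : 0 ≤ e) :
    impurity p q ≤ impurity (p + d) (q + e) ∧
      impurity (p + d) (q + e) ≤ impurity p q + (d + e) := by
  obtain ⟨h1, h2⟩ := impurity_add_left hp hq hd
  obtain ⟨h3, h4⟩ := impurity_add_left hq (add_nonneg hp hd) he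
  rw [impurity_comm q, impurity_comm (q + e)] at h3 h4
  constructor <;> linarith

theorem card_eq_count_add_count (s : Multiset ℤˣ) :
    Multiset.card s = s.count 1 + s.count (-1) := by
  induction s using Multiset.induction_on with
  | empty => simp
  | cons y s ih =>
    rw [Multiset.card_cons, Multiset.count_cons, Multiset.count_cons, ih]
    rcases Int.units_eq_one_or y with rfl | rfl
    · simp [show ((-1 : ℤˣ) = 1) = False by decide]; omega
    · simp [show ((1 : ℤˣ) = -1) = False by decide]; omega

/-- With `p` and `q` items of the two labels, `(p + q) * (1 - (p ^ 2 + q ^ 2) / (p + q) ^ 2) = 2 * p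
* q / (p + q)`. -/
theorem card_mul_gini (s : Multiset ℤˣ) :
    (Multiset.card s : ℝ) * gini s = 2 * impurity (s.count 1) (s.count (-1)) := by
  by_cases h : s = 0
  · simp [h, gini, impurity]
  have hc : (Multiset.card s : ℝ) = s.count 1 + s.count (-1) := by
    exact_mod_cast card_eq_count_add_count s
  have hpos : (0 : ℝ) < s.count 1 + s.count (-1) := by
    rw [← hc]
    exact_mod_cast Multiset.card_pos.mpr h
  have hsum : ∑ y ∈ s.toFinset, ((s.count y : ℝ) / (Multiset.card s : ℝ)) ^ 2 =
      ((s.count 1 : ℝ) / (Multiset.card s : ℝ)) ^ 2 +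
        ((s.count (-1) : ℝ) / (Multiset.card s : ℝ)) ^ 2 := by
    rw [Finset.sum_subset (Finset.subset_univ _) (fun y _ hy => by
      rw [Multiset.mem_toFinset] at hy
      simp [Multiset.count_eq_zero_of_notMem hy])]
    rw [show (Finset.univ : Finset ℤˣ) = {1, -1} from rfl, Finset.sum_pair (by decide)]
  rw [gini, if_neg h, hsum, hc, impurity]
  field_simp
  ring

/-- The number of items with label `y`. -/
def labelCount (σ : List (ℕ × ℤˣ)) (y : ℕ) : ℕ := σ.countP fun p => StreamAlg.encode p.2 = y

theorem encode_eq_one {y : ℤˣ} : StreamAlg.encode y = 1 ↔ y = 1 := by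
  rcases Int.units_eq_one_or y with rfl | rfl <;> simp [StreamAlg.encode]

theorem encode_eq_zero {y : ℤˣ} : StreamAlg.encode y = 0 ↔ y = -1 := by
  rcases Int.units_eq_one_or y with rfl | rfl <;>
    simp [StreamAlg.encode, show ((1 : ℤˣ) = -1) = False by decide]

theorem count_leftLabels (σ : List (ℕ × ℤˣ)) (j : ℕ) :
    (leftLabels σ j).count 1 = leftCount σ j 1 ∧ (leftLabels σ j).count (-1) = leftCount σ j 0 := by
  simp only [leftLabels, Multiset.coe_count, leftCount, encode_eq_one, encode_eq_zero,
    List.count, List.countP_map, List.countP_filter]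
  constructor <;> refine List.countP_congr fun p _ => ?_ <;>
    simp [and_comm]

theorem count_rightLabels (σ : List (ℕ × ℤˣ)) (j : ℕ) :
    (rightLabels σ j).count 1 + leftCount σ j 1 = labelCount σ 1 ∧
      (rightLabels σ j).count (-1) + leftCount σ j 0 = labelCount σ 0 := by
  simp only [rightLabels, Multiset.coe_count, leftCount, labelCount, encode_eq_one,
    encode_eq_zero, List.count]
  induction σ with
  | nil => simp
  | cons p σ ih =>
    obtain ⟨ih1, ih2⟩ := ih
    rw [List.filter_cons]
    by_cases h : j + 1 ≤ p.1
    · have h' : ¬ p.1 ≤ j := by omega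
      simp only [h, h', decide_true, if_true, List.map_cons, List.countP_cons, beq_iff_eq,
        false_and, decide_false, Bool.false_eq_true, if_false, decide_eq_true_eq]
      omega
    · have h' : p.1 ≤ j := by omega
      simp only [h, h', if_false, List.countP_cons, true_and, decide_false, Bool.false_eq_true,
        decide_eq_true_eq]
      omega

theorem labelCount_add (σ : List (ℕ × ℤˣ)) : labelCount σ 0 + labelCount σ 1 = σ.length := by
  induction σ with
  | nil => simp [labelCount]
  | cons p σ ih =>
    have := StreamAlg.encode_lt_two p.2
    simp only [labelCount, List.countP_cons, List.length_cons, decide_eq_true_eq] at ih ⊢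
    split_ifs <;> omega

/-- The right part is written as total minus left part, so that the label totals, known exactly, and
estimates of the left counts determine an estimate of the loss. -/
theorem giniLoss_eq (σ : List (ℕ × ℤˣ)) (j : ℕ) : giniLoss σ j = 2 / (σ.length : ℝ) *
    (impurity (leftCount σ j 1) (leftCount σ j 0) +
      impurity ((labelCount σ 1 : ℝ) - leftCount σ j 1)
        ((labelCount σ 0 : ℝ) - leftCount σ j 0)) := by
  obtain ⟨l1, l0⟩ := count_leftLabels σ j
  obtain ⟨r1, r0⟩ := count_rightLabels σ j
  have r1' : (labelCount σ 1 : ℝ) - leftCount σ j 1 = (rightLabels σ j).count 1 := by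
    rw [← r1]; push_cast; ring
  have r0' : (labelCount σ 0 : ℝ) - leftCount σ j 0 = (rightLabels σ j).count (-1) := by
    rw [← r0]; push_cast; ring
  rw [r1', r0', ← l1, ← l0, giniLoss, div_mul_eq_mul_div, div_mul_eq_mul_div, card_mul_gini,
    card_mul_gini]
  ring

theorem natCast_div_bounds (n d : ℕ) :
    ((n / d : ℕ) : ℝ) ≤ (n : ℝ) / d ∧ (n : ℝ) / d ≤ ((n / d : ℕ) : ℝ) + 1 := by
  refine ⟨Nat.cast_div_le, ?_⟩
  rw [← Nat.floor_div_eq_div (K := ℝ) n d]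
  exact (Nat.lt_floor_add_one _).le

/-- The score of a split is its loss, up to a factor and rounding. -/
theorem splitScore_bounds {M t P Z x0 x1 : ℕ} (ht : Z + P = t) (h0 : x0 ≤ Z) (h1 : x1 ≤ P) :
    (splitScore M t P (x0 + x1) x1 : ℝ) ≤
        M * (impurity x1 x0 + impurity ((P : ℝ) - x1) ((Z : ℝ) - x0)) ∧
      M * (impurity x1 x0 + impurity ((P : ℝ) - x1) ((Z : ℝ) - x0)) ≤
        splitScore M t P (x0 + x1) x1 + 2 := by
  have e1 : x0 + x1 - x1 = x0 := by omega
  have e2 : t - (x0 + x1) = (P - x1) + (Z - x0) := by omega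
  have e3 : (P - x1) + (Z - x0) - (P - x1) = Z - x0 := by omega
  rw [splitScore, e1, e2, e3]
  obtain ⟨a1, a2⟩ := natCast_div_bounds (x0 * x1 * M) (x0 + x1)
  obtain ⟨b1, b2⟩ := natCast_div_bounds ((Z - x0) * (P - x1) * M) ((P - x1) + (Z - x0))
  have a3 : ((x0 * x1 * M : ℕ) : ℝ) / ((x0 + x1 : ℕ) : ℝ) = M * impurity x1 x0 := by
    rw [impurity]; push_cast; rw [add_comm (x1 : ℝ)]; ring
  have b3 : (((Z - x0) * (P - x1) * M : ℕ) : ℝ) / (((P - x1) + (Z - x0) : ℕ) : ℝ) =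
      M * impurity ((P : ℝ) - x1) ((Z : ℝ) - x0) := by
    rw [impurity]; push_cast [Nat.cast_sub h0, Nat.cast_sub h1]; ring
  rw [a3] at a1 a2
  rw [b3] at b1 b2
  push_cast at *
  constructor <;> linarith

/-- The loss of a split and its value according to the trie differ by the misplaced items. -/
theorem impurity_split_bounds {l0 l1 x0 x1 d0 d1 Z P : ℕ} (hx0 : x0 ≤ l0) (hx1 : x1 ≤ l1)
    (hd0 : l0 ≤ x0 + d0) (hd1 : l1 ≤ x1 + d1) (h0 : l0 ≤ Z) (h1 : l1 ≤ P) :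
    |(impurity x1 x0 + impurity ((P : ℝ) - x1) ((Z : ℝ) - x0)) -
      (impurity l1 l0 + impurity ((P : ℝ) - l1) ((Z : ℝ) - l0))| ≤ d0 + d1 := by
  obtain ⟨e0, rfl⟩ := Nat.exists_eq_add_of_le hx0
  obtain ⟨e1, rfl⟩ := Nat.exists_eq_add_of_le hx1
  obtain ⟨f0, rfl⟩ := Nat.exists_eq_add_of_le h0
  obtain ⟨f1, rfl⟩ := Nat.exists_eq_add_of_le h1
  have g0 : (e0 : ℝ) ≤ d0 := by exact_mod_cast (by omega : e0 ≤ d0)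
  have g1 : (e1 : ℝ) ≤ d1 := by exact_mod_cast (by omega : e1 ≤ d1)
  have n : ∀ k : ℕ, (0 : ℝ) ≤ k := fun k => Nat.cast_nonneg k
  -- Moving `e0 + e1` items across the split raises one impurity and lowers the other, each by at
  -- most `e0 + e1`. The two changes have opposite signs, so the bound is not doubled.
  obtain ⟨a1, a2⟩ := impurity_add (n x1) (n x0) (n e1) (n e0)
  obtain ⟨b1, b2⟩ := impurity_add (n f1) (n f0) (n e1) (n e0)
  have r1 : ((x1 + e1 + f1 : ℕ) : ℝ) - x1 = f1 + e1 := by push_cast; ring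
  have r0 : ((x0 + e0 + f0 : ℕ) : ℝ) - x0 = f0 + e0 := by push_cast; ring
  have s1 : ((x1 + e1 + f1 : ℕ) : ℝ) - (x1 + e1 : ℕ) = f1 := by push_cast; ring
  have s0 : ((x0 + e0 + f0 : ℕ) : ℝ) - (x0 + e0 : ℕ) = f0 := by push_cast; ring
  rw [r1, r0, s1, s0]
  push_cast
  rw [abs_le]
  constructor <;> linarith

theorem leftCount_le_labelCount (σ : List (ℕ × ℤˣ)) (j y : ℕ) :
    leftCount σ j y ≤ labelCount σ y :=
  List.countP_mono_left fun p _ h => by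
    simp only [decide_eq_true_eq] at h ⊢
    exact h.2

/-- A split of least score is nearly optimal. -/
theorem giniLoss_le_of_score {L E t N j : ℕ} {H ε : ℝ} {σ : List (ℕ × ℤˣ)} {T : Trie}
    (hT : T.Tracks L (L * 16 * E) t H σ) (hσ : σ.length = t) (ht : 0 < t) (hL : 1 ≤ L)
    (hE : 1 / ε ≤ E) (hε : 0 < ε)
    (hj : ∀ k ≤ N, T.score E t (labelCount σ 1) j ≤ T.score E t (labelCount σ 1) k) :
    giniLoss σ j ≤ optGini N σ + ε := by
  obtain ⟨k, hk, hopt⟩ := Finset.exists_mem_eq_inf' (Finset.nonempty_range_add_one (n := N))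
    (giniLoss σ)
  rw [optGini, hopt]
  have hjk := hj k (Nat.lt_succ_iff.mp (Finset.mem_range.mp hk))
  set G : ℕ → ℝ := fun i => impurity (leftCount σ i 1) (leftCount σ i 0) +
      impurity ((labelCount σ 1 : ℝ) - leftCount σ i 1)
        ((labelCount σ 0 : ℝ) - leftCount σ i 0) with hG
  have key : ∀ i, (T.score E t (labelCount σ 1) i : ℝ) ≤ (E * 16) * G i + t ∧
      (E * 16) * G i ≤ T.score E t (labelCount σ 1) i + 2 + t := by
    intro i
    have c0 := hT.counts i 0
    have c1 := hT.counts i 1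
    have l0 := leftCount_le_labelCount σ i 0
    have l1 := leftCount_le_labelCount σ i 1
    obtain ⟨s1, s2⟩ := splitScore_bounds (M := E * 16) (t := t) (P := labelCount σ 1)
      (Z := labelCount σ 0) (x0 := T.below i 0) (x1 := T.below i 1)
      (by rw [labelCount_add, hσ]) (c0.1.trans l0) (c1.1.trans l1)
    have d := abs_le.mp (impurity_split_bounds c0.1 c1.1 c0.2 c1.2 l0 l1)
    -- The factor `L` in `K` cancels the number of levels.
    have hacross : (T.across i 0 + T.across i 1) * (E * 16) ≤ t := by
      have := Trie.across_le hT.wf hT.capped i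
      refine Nat.le_of_mul_le_mul_left (?_ : L * _ ≤ L * t) hL
      calc L * ((T.across i 0 + T.across i 1) * (E * 16))
          = (T.across i 0 + T.across i 1) * (L * 16 * E) := by ring
        _ ≤ L * t := this
    have hac : ((T.across i 0 : ℝ) + T.across i 1) * (E * 16) ≤ t := by exact_mod_cast hacross
    have hE0 : (0 : ℝ) ≤ E * 16 := by positivity
    have m1 := mul_le_mul_of_nonneg_left d.1 hE0
    have m2 := mul_le_mul_of_nonneg_left d.2 hE0
    rw [Trie.score]
    push_cast at s1 s2
    rw [mul_sub] at m1 m2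
    simp only [hG]
    constructor <;> nlinarith
  have hjk' : (T.score E t (labelCount σ 1) j : ℝ) ≤ T.score E t (labelCount σ 1) k := by
    exact_mod_cast hjk
  -- The misplaced items cost `t` for each of the two splits, and rounding down two quotients costs
  -- `2`.
  have hmain : (E * 16) * G j ≤ (E * 16) * G k + (2 + 2 * t) := by
    linarith [(key j).2, (key k).1]
  have hinv : 0 < 1 / ε := by positivity
  have hE0 : (0 : ℝ) < E := hinv.trans_le hE
  have ht0 : (1 : ℝ) ≤ t := by exact_mod_cast ht
  have hdiff : G j ≤ G k + (2 + 2 * t) / (E * 16) := by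
    have := div_le_div_of_nonneg_right hmain (by positivity : (0 : ℝ) ≤ E * 16)
    rwa [add_div, mul_div_cancel_left₀ _ (by positivity), mul_div_cancel_left₀ _ (by positivity)]
      at this
  have hεE : 1 ≤ ε * E := by
    have := mul_le_mul_of_nonneg_left hE hε.le
    rwa [mul_one_div_cancel hε.ne'] at this
  -- For `t ≥ 1` the left side is at most `1 / (2 * E)`, and `1 ≤ ε * E`.
  have herr : 2 / (t : ℝ) * ((2 + 2 * t) / (E * 16)) ≤ ε := by
    rw [div_mul_div_comm, div_le_iff₀ (by positivity)]
    nlinarith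
  rw [giniLoss_eq, giniLoss_eq, hσ]
  calc 2 / (t : ℝ) * G j ≤ 2 / (t : ℝ) * (G k + (2 + 2 * t) / (E * 16)) :=
        mul_le_mul_of_nonneg_left hdiff (by positivity)
    _ = 2 / (t : ℝ) * G k + 2 / (t : ℝ) * ((2 + 2 * t) / (E * 16)) := mul_add _ _ _
    _ ≤ _ := by linarith

/-! ### Complete executions. -/

/-- The streaming algorithm. -/
def trieAlg : StreamAlg where
  setup := setupProg
  update := updateProg
  finish := finishProg

/-- What is known about a configuration after the stream `σ` has been read. -/
structure Good (S B N E : ℕ) (σ : List (ℕ × ℤˣ)) (L : ℕ) (T : Trie) (s : Config) : Prop where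
  one_le : 1 ≤ L
  pow_le : 2 ^ L ≤ 2 * N
  lt_pow : N < 2 ^ L
  machine : Machine N E L σ.length (labelCount σ 1) T s.mem
  tracks : T.Tracks L (L * 16 * E) σ.length ((L + 1) * (harmonic σ.length : ℝ)) σ
  within : s.Within S B
  time_le : σ ≠ [] → s.time ≤ 16 + 25 * L

theorem StreamAlg.after_append (A : StreamAlg) (N E : ℕ) (σ : List (ℕ × ℤˣ)) (p : ℕ × ℤˣ) :
    A.after N E (σ ++ [p]) = (A.after N E σ).bind fun s => A.feed s p := by
  simp [after, List.foldl_append]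

theorem labelCount_append (σ : List (ℕ × ℤˣ)) (p : ℕ × ℤˣ) :
    labelCount (σ ++ [p]) 1 = labelCount σ 1 + StreamAlg.encode p.2 := by
  have := StreamAlg.encode_lt_two p.2
  simp only [labelCount, List.countP_append, List.countP_singleton, decide_eq_true_eq]
  split_ifs <;> omega

/-- Induction along the stream. The `L + 1` deposits of `1 / t` made for the item at time `t` are
exactly the increment of `(L + 1) * harmonic t`. The parameter `n` fixes one pair of bounds `S`, `B`
for all prefixes. -/
theorem good_after {S B N E n : ℕ} (hN : 1 ≤ N) (hE : 1 ≤ E) (hS : 45 ≤ S)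
    (hB : S + 32 * (N * E) + 32 * (n * n * E) + n + N ≤ B)
    (hroom : ∀ (L t : ℕ) (T : Trie), 2 ^ L ≤ 2 * N → t ≤ n →
      T.Credit (L * 16 * E) t ((L + 1) * (harmonic t : ℝ)) → 5 * (T.size + 9) ≤ S)
    (σ : List (ℕ × ℤˣ)) (hlen : σ.length ≤ n) (hσ : ∀ p ∈ σ, 1 ≤ p.1 ∧ p.1 ≤ N) :
    ∀ s ∈ (trieAlg.after N E σ).support, ∃ L T, Good S B N E σ L T s := by
  have hNE : N ≤ N * E := Nat.le_mul_of_pos_right _ hE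
  have hEN : E ≤ N * E := Nat.le_mul_of_pos_left _ hN
  induction σ using List.reverseRecOn with
  | nil =>
    intro s hs
    have h2 : 2 * N * 16 * E ≤ B := by
      calc 2 * N * 16 * E = 32 * (N * E) := by ring
        _ ≤ B := by omega
    obtain ⟨⟨L, g1, g2, g3, g4⟩, hw⟩ := Cmd.wp_sound setupProg
      (fun m _ => ∃ L, 1 ≤ L ∧ 2 ^ L ≤ 2 * N ∧ N < 2 ^ L ∧ Machine N E L 0 0 (Trie.root L) m)
      (StreamAlg.start N E)
      (wp_setupProg (S := S) (B := B) rfl rfl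
        (fun a ha => by
          simp only [StreamAlg.start]
          rw [if_neg (by omega), if_neg (by omega)])
        hN hE hS (by omega) h2 fun m L _ g1 g2 g3 g4 => ⟨L, g1, g2, g3, g4⟩)
      ⟨by simp only [StreamAlg.start]; omega, by simp only [StreamAlg.start]; omega⟩ s hs
    exact ⟨L, Trie.root L, g1, g2, g3, g4, by simpa using Trie.Tracks.root L (L * 16 * E) 0, hw,
      fun h => absurd rfl h⟩
  | append_singleton σ p ih =>
    intro s' hs'
    rw [StreamAlg.after_append, PMF.mem_support_bind_iff] at hs'
    obtain ⟨s, hs, hs'⟩ := hs'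
    rw [List.length_append, List.length_singleton] at hlen
    obtain ⟨L, T, h⟩ := ih (by omega) (fun q hq => hσ q (List.mem_append_left _ hq)) s hs
    obtain ⟨hp1, hpN⟩ := hσ p (by simp)
    have hy := StreamAlg.encode_lt_two p.2
    have hH : ((L : ℝ) + 1) * (harmonic (σ.length + 1) : ℝ) =
        (L + 1) * (harmonic σ.length : ℝ) + (L + 1) * (1 / (σ.length + 1 : ℕ)) := by
      rw [harmonic_succ]
      push_cast
      ring
    have hL : L < 2 ^ L := Nat.lt_two_pow_self
    have hLE : L * 16 * E ≤ 32 * (N * E) := by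
      calc L * 16 * E = 16 * (L * E) := by ring
        _ ≤ 16 * (2 * N * E) := by
          refine Nat.mul_le_mul_left _ (Nat.mul_le_mul_right _ ?_)
          exact hL.le.trans h.pow_le
        _ = 32 * (N * E) := by ring
    have hP : labelCount σ 1 ≤ σ.length := by rw [← labelCount_add]; omega
    have h1 := h.pow_le
    have hm : Machine N E L σ.length (labelCount σ 1) T
        (Function.update (Function.update s.mem 2 p.1) 3 (StreamAlg.encode p.2)) :=
      (h.machine.scratch (by omega) _).scratch (by omega) _
    obtain ⟨⟨hτ, T', hm', hT'⟩, hw⟩ := Cmd.wp_sound updateProg _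
      { (s.put 2 p.1).put 3 (StreamAlg.encode p.2) with time := 0 }
      (wp_updateProg (S := S) (B := B) (τ := 0) hm h.tracks
        (by simp [Config.put]) (by simp [Config.put]) (hpN.trans_lt h.lt_pow)
        (fun T hT => hroom L (σ.length + 1) T h.pow_le hlen (hH ▸ hT)) (by omega) (by omega)
        (by omega) (by omega) (by omega))
      (by
        obtain ⟨w1, w2⟩ := h.within
        constructor <;> simp only [Config.put] <;> omega) s' hs'
    refine ⟨L, T', h.one_le, h.pow_le, h.lt_pow, ?_, ?_, hw, fun _ => by omega⟩
    · rwa [labelCount_append, List.length_append, List.length_singleton]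
    · rw [List.length_append, List.length_singleton, hH]
      exact hT'

theorem good_run {S B N E : ℕ} {ε : ℝ} (hε : 0 < ε) (hE' : 1 / ε ≤ E) {σ : List (ℕ × ℤˣ)}
    (hne : σ ≠ []) (hN : 1 ≤ N) (hE : 1 ≤ E) (hS : 45 ≤ S)
    (hB : S + 32 * (N * E) + 32 * (σ.length * σ.length * E) + σ.length + N ≤ B)
    (hroom : ∀ (L t : ℕ) (T : Trie), 2 ^ L ≤ 2 * N → t ≤ σ.length →
      T.Credit (L * 16 * E) t ((L + 1) * (harmonic t : ℝ)) → 5 * (T.size + 9) ≤ S)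
    (hσ : ∀ p ∈ σ, 1 ≤ p.1 ∧ p.1 ≤ N) :
    ∀ u ∈ (trieAlg.run N E σ).support, u.Within S B ∧ u.mem 0 ≤ N ∧
      giniLoss σ (u.mem 0) ≤ optGini N σ + ε := by
  intro u hu
  rw [StreamAlg.run, PMF.mem_support_bind_iff] at hu
  obtain ⟨s, hs, hu⟩ := hu
  obtain ⟨L, T, h⟩ := good_after hN hE hS hB hroom σ le_rfl hσ s hs
  have h1 := h.pow_le
  have hNE : N ≤ N * E := Nat.le_mul_of_pos_right _ hE
  have hEN : E ≤ N * E := Nat.le_mul_of_pos_left _ hN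
  have hP : labelCount σ 1 ≤ σ.length := by rw [← labelCount_add]; omega
  have h2 : 2 * (σ.length * σ.length * (E * 16)) ≤ B := by
    calc _ = 32 * (σ.length * σ.length * E) := by ring
      _ ≤ B := by omega
  obtain ⟨⟨g1, g2⟩, hw⟩ := Cmd.wp_sound finishProg _ s
    (wp_finishProg (S := S) (B := B) h.machine h.tracks rfl hP hE
      (hroom L _ T h.pow_le le_rfl h.tracks.credit) (by omega) (by omega) h2 (by omega) (by omega))
    h.within u hu
  exact ⟨hw, g1, giniLoss_le_of_score h.tracks rfl (List.length_pos_of_ne_nil hne) h.one_le hE'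
    hε g2⟩

/-! ### Numerical bounds on space and word length. -/

/-- The number of cells that suffice for the algorithm. -/
def cellBound (N E n : ℕ) : ℕ :=
  5 * (⌊1 + 2 * ((Nat.log 2 (2 * N) * 16 * E : ℕ) : ℝ) *
    ((Nat.log 2 (2 * N) + 1) * (1 + Real.log n))⌋₊ + 9)

theorem size_le_cellBound {N E n L t : ℕ} {T : Trie} (hL : 2 ^ L ≤ 2 * N) (ht : t ≤ n)
    (hT : T.Credit (L * 16 * E) t ((L + 1) * (harmonic t : ℝ))) :
    5 * (T.size + 9) ≤ cellBound N E n := by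
  have hLl : L ≤ Nat.log 2 (2 * N) := Nat.le_log_of_pow_le (by norm_num) hL
  have hlog : (harmonic t : ℝ) ≤ 1 + Real.log n := by
    refine (harmonic_le_one_add_log t).trans ?_
    rcases Nat.eq_zero_or_pos t with rfl | ht0
    · have := Real.log_natCast_nonneg n
      simpa using this
    · have : Real.log t ≤ Real.log n :=
        Real.log_le_log (by exact_mod_cast ht0) (by exact_mod_cast ht)
      linarith
  have hh : (0 : ℝ) ≤ harmonic t := by
    rw [harmonic]; positivity
  have hK : ((L * 16 * E : ℕ) : ℝ) ≤ (Nat.log 2 (2 * N) * 16 * E : ℕ) := by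
    exact_mod_cast Nat.mul_le_mul_right _ (Nat.mul_le_mul_right _ hLl)
  have hL' : (L : ℝ) ≤ Nat.log 2 (2 * N) := by exact_mod_cast hLl
  have : T.size ≤ ⌊1 + 2 * ((Nat.log 2 (2 * N) * 16 * E : ℕ) : ℝ) *
      ((Nat.log 2 (2 * N) + 1) * (1 + Real.log n))⌋₊ := by
    refine Nat.le_floor (hT.size_le.trans ?_)
    gcongr
  rw [cellBound]
  omega

theorem natLog_le {n : ℕ} {x : ℝ} (hn : 0 < n) (hx : Real.log n ≤ x) : (Nat.log 2 n : ℝ) ≤ 2 * x := by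
  have h1 : ((2 ^ Nat.log 2 n : ℕ) : ℝ) ≤ n := by exact_mod_cast Nat.pow_log_le_self 2 hn.ne'
  have h2 := Real.log_le_log (by positivity) h1
  push_cast at h2
  rw [Real.log_pow] at h2
  have h3 := Real.log_two_gt_d9
  have h4 : (0 : ℝ) ≤ Nat.log 2 n := Nat.cast_nonneg _
  nlinarith

theorem natSize_le {n : ℕ} {x : ℝ} (hx : Real.log n ≤ x) (hx0 : 0 ≤ x) :
    (n.size : ℝ) ≤ 1 + 2 * x := by
  rcases Nat.eq_zero_or_pos n with rfl | hn
  · simp; linarith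
  · have h := natLog_le hn hx
    have : n.size ≤ Nat.log 2 n + 1 := Nat.size_le.mpr (Nat.lt_pow_succ_log_self (by norm_num) n)
    have : (n.size : ℝ) ≤ Nat.log 2 n + 1 := by exact_mod_cast this
    linarith

/-- The node bound becomes `1 + 1536 * e * x ^ 3`; five cells per node and `45` spare ones give `50
+ 7680 * e * x ^ 3`, and `1 ≤ 8 * e * x ^ 3` turns `50` into `400 * e * x ^ 3`. -/
theorem cellBound_le {N E n : ℕ} {e x : ℝ} (he : 1 ≤ e) (hE : (E : ℝ) ≤ 2 * e) (hx : 1 ≤ 2 * x)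
    (hN : (Nat.log 2 (2 * N) : ℝ) ≤ 2 * x) (hn : Real.log n ≤ x) :
    (cellBound N E n : ℝ) ≤ 8080 * e * x ^ 3 := by
  have hx0 : 0 ≤ x := by linarith
  have he0 : 0 ≤ e := by linarith
  have hn0 := Real.log_natCast_nonneg n
  have h1 : 1 + 2 * ((Nat.log 2 (2 * N) * 16 * E : ℕ) : ℝ) *
      ((Nat.log 2 (2 * N) + 1) * (1 + Real.log n)) ≤
      1 + 2 * (2 * x * 16 * (2 * e)) * ((2 * x + 2 * x) * (2 * x + x)) := by
    push_cast
    gcongr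
  have h2 := (Nat.floor_le (by positivity : (0 : ℝ) ≤ 1 + 2 *
    ((Nat.log 2 (2 * N) * 16 * E : ℕ) : ℝ) *
      ((Nat.log 2 (2 * N) + 1) * (1 + Real.log n)))).trans h1
  have h3 : (1 : ℝ) ≤ (2 * x) ^ 3 := one_le_pow₀ hx
  have h4 : 1 * 1 ≤ e * (2 * x) ^ 3 := mul_le_mul he h3 zero_le_one he0
  rw [cellBound]
  push_cast at h2 ⊢
  nlinarith

end GiniStream
end

/-! ### The theorem. -/

theorem mainTheorem2 (c : ℕ) :
    ∃ (A : GiniStream.StreamAlg) (C : ℝ) (d : ℕ),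
      ∀ (ε : ℝ), 0 < ε → ε < 1 →
      ∀ (N : ℕ) (σ : List (ℕ × ℤˣ)), σ ≠ [] → (∀ p ∈ σ, 1 ≤ p.1 ∧ p.1 ≤ N) →
        (∀ t ∈ (A.run N ⌈1 / ε⌉₊ σ).support,
          (t.wordLength : ℝ) ≤ C * Real.log (2 * N * σ.length / ε) ∧
          (A.spaceBits t : ℝ) ≤ C * (1 / ε) * Real.log (2 * N * σ.length / ε) ^ d) ∧
        (∀ s ∈ (A.after N ⌈1 / ε⌉₊ σ).support,
          (s.time : ℝ) ≤ C * Real.log (2 * N * σ.length / ε) ^ d) ∧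
        1 - 1 / ((N : ENNReal) + 1) ^ c ≤
          (A.run N ⌈1 / ε⌉₊ σ).toOuterMeasure
            {t | t.mem 0 ≤ N ∧
              GiniStream.giniLoss σ (t.mem 0) ≤ GiniStream.optGini N σ + ε} := by
  -- One algorithm serves every `c`. The exponent `4` is three for the cells and one for the word
  -- length; the constant exceeds `8100 * 38`.
  refine ⟨GiniStream.trieAlg, 400000, 4, ?_⟩
  intro ε hε hε1 N σ hne hσ
  have hN : 1 ≤ N := by
    obtain ⟨p, hp⟩ := List.exists_mem_of_ne_nil σ hne
    exact (hσ p hp).1.trans (hσ p hp).2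
  have hn : 1 ≤ σ.length := List.length_pos_of_ne_nil hne
  set n := σ.length with hn_def
  set E := ⌈1 / ε⌉₊ with hE_def
  set e := 1 / ε with he_def
  have he1 : 1 ≤ e := by rw [he_def, le_div_iff₀ hε]; linarith
  have hEe : e ≤ E := Nat.le_ceil _
  have hE2 : (E : ℝ) ≤ 2 * e := by
    have := Nat.ceil_lt_add_one (by linarith : 0 ≤ e)
    linarith
  have hE : 1 ≤ E := Nat.one_le_cast.mp (he1.trans hEe)
  have hN' : (1 : ℝ) ≤ N := by exact_mod_cast hN
  have hn' : (1 : ℝ) ≤ n := by exact_mod_cast hn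
  have hYe : 2 * (N : ℝ) * n / ε = 2 * N * n * e := by rw [he_def]; ring
  rw [hYe]
  set Y := 2 * (N : ℝ) * n * e with hY
  have hNn : (N : ℝ) ≤ N * n := le_mul_of_one_le_right (by positivity) hn'
  have hnN : (n : ℝ) ≤ N * n := le_mul_of_one_le_left (by positivity) hN'
  have hNne : (N : ℝ) * n ≤ N * n * e := le_mul_of_one_le_right (by positivity) he1
  have heY : e ≤ N * n * e := le_mul_of_one_le_left (by positivity) (by nlinarith)
  have hY2 : 2 ≤ Y := by linarith
  have hY0 : 0 < Y := by linarith
  set x := Real.log Y with hx_def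
  -- Since `Y ≥ 2`, the logarithm is bounded below, which lets additive constants be absorbed into
  -- powers of `x`.
  have hx : 1 ≤ 2 * x := by
    have h1 := Real.log_le_log (by norm_num) hY2
    have h2 := Real.log_two_gt_d9
    linarith
  have hx0 : 0 ≤ x := by linarith
  have hxY : x ≤ Y := Real.log_le_self hY0.le
  have hlogn : Real.log n ≤ x := Real.log_le_log (by linarith) (by linarith)
  have hlogN : (Nat.log 2 (2 * N) : ℝ) ≤ 2 * x := by
    refine GiniStream.natLog_le (by omega) (Real.log_le_log ?_ ?_) <;> push_cast <;> linarith
  set S := GiniStream.cellBound N E n with hS_def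
  have hSle : (S : ℝ) ≤ 8080 * e * x ^ 3 := GiniStream.cellBound_le he1 hE2 hx hlogN hlogn
  have hS : 45 ≤ S := by rw [hS_def, GiniStream.cellBound]; omega
  set B := S + 32 * (N * E) + 32 * (n * n * E) + n + N with hB_def
  have hroom : ∀ (L t : ℕ) (T : GiniStream.Trie), 2 ^ L ≤ 2 * N → t ≤ n →
      T.Credit (L * 16 * E) t ((L + 1) * (harmonic t : ℝ)) → 5 * (T.size + 9) ≤ S :=
    fun L t T h1 h2 h3 => GiniStream.size_le_cellBound h1 h2 h3
  -- All summands of `B` together are at most `2 ^ 14 * Y ^ 4`, and `2 ≤ Y`. Only the logarithm of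
  -- this bound matters: `B` is polynomial in `Y`, so words have `O(log Y)` bits.
  have hBY : (B : ℝ) ≤ Y ^ 18 := by
    have h1 : (N : ℝ) * E ≤ Y := by
      calc (N : ℝ) * E ≤ (N * n) * (2 * e) := by gcongr
        _ = Y := by rw [hY]; ring
    have h2 : (n : ℝ) * n * E ≤ Y ^ 2 := by
      calc (n : ℝ) * n * E ≤ (N * n) * (N * n) * (2 * e) := by gcongr
        _ ≤ (2 * (N * n)) * (2 * (N * n)) * (e * e) := by nlinarith [mul_self_nonneg ((N : ℝ) * n)]
        _ = Y ^ 2 := by rw [hY]; ring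
    have h3 : e * x ^ 3 ≤ Y * Y ^ 3 := by
      gcongr
      linarith
    have h4 : Y ≤ Y ^ 4 := le_self_pow₀ (by linarith) (by norm_num)
    have h5 : Y ^ 2 ≤ Y ^ 4 := pow_le_pow_right₀ (by linarith) (by norm_num)
    have h6 : (2 : ℝ) ^ 14 ≤ Y ^ 14 := pow_le_pow_left₀ (by norm_num) hY2 14
    have h7 : (2 : ℝ) ^ 14 * Y ^ 4 ≤ Y ^ 14 * Y ^ 4 := by gcongr
    rw [hB_def]
    push_cast
    calc (S : ℝ) + 32 * (N * E) + 32 * (n * n * E) + n + N ≤ 2 ^ 14 * Y ^ 4 := by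
          norm_num
          nlinarith
      _ ≤ Y ^ 14 * Y ^ 4 := h7
      _ = Y ^ 18 := by ring
  have hsize : (B.size : ℝ) ≤ 38 * x := by
    have h1 : Real.log B ≤ 18 * x := by
      have hB0 : (0 : ℝ) < B := by exact_mod_cast (by omega : 0 < B)
      have := Real.log_le_log hB0 hBY
      rw [Real.log_pow] at this
      exact_mod_cast this
    have := GiniStream.natSize_le h1 (by positivity)
    linarith
  have hrun := GiniStream.good_run hε hEe hne hN hE hS le_rfl hroom hσ
  have hx3 : (1 : ℝ) ≤ (2 * x) ^ 3 := one_le_pow₀ hx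
  refine ⟨?_, ?_, ?_⟩
  · intro t ht
    obtain ⟨⟨hcells, htop⟩, -, -⟩ := hrun t ht
    have hw : (t.wordLength : ℝ) ≤ 38 * x := by
      refine le_trans ?_ hsize
      exact_mod_cast Nat.size_le_size htop
    refine ⟨by linarith, ?_⟩
    have hc : (t.cells : ℝ) + 2 ≤ 8100 * e * x ^ 3 := by
      have h1 : (t.cells : ℝ) ≤ S := by exact_mod_cast hcells
      have h2 : 1 * 1 ≤ e * (2 * x) ^ 3 := mul_le_mul he1 hx3 zero_le_one (by linarith)
      nlinarith
    have hdepth : GiniStream.trieAlg.loopDepth = 2 := by decide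
    rw [GiniStream.StreamAlg.spaceBits, hdepth]
    push_cast
    calc ((t.cells : ℝ) + 2) * t.wordLength ≤ (8100 * e * x ^ 3) * (38 * x) := by gcongr
      _ = 307800 * (e * x ^ 4) := by ring
      _ ≤ 400000 * (e * x ^ 4) := by gcongr; norm_num
      _ = 400000 * e * x ^ 4 := by ring
  · intro s hs
    obtain ⟨L, T, h⟩ := GiniStream.good_after hN hE hS le_rfl hroom σ le_rfl hσ s hs
    have h1 : (s.time : ℝ) ≤ 16 + 25 * L := by exact_mod_cast h.time_le hne
    have h2 : (L : ℝ) ≤ Nat.log 2 (2 * N) := by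
      exact_mod_cast Nat.le_log_of_pow_le (by norm_num) h.pow_le
    have h3 : 2 * x ≤ (2 * x) ^ 4 := le_self_pow₀ hx (by norm_num)
    nlinarith
  -- The set has measure exactly `1`, because the guarantee holds on the whole support.
  · refine tsub_le_self.trans (le_of_eq ?_)
    symm
    rw [PMF.toOuterMeasure_apply_eq_one_iff]
    exact fun u hu => (hrun u hu).2
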